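/- Let $2^{<\omega}$ be the set of finite binary strings; for strings $\sigma,\tau$ let $|\sigma|$ be the length of $\sigma$ and $\sigma\wedge\tau$ the longest common initial segment. Let $\sigma<_{\mathbb Q}\tau$ mean that $\sigma$ is a proper initial segment of $\tau$ and $\tau(|\sigma|)=1$, or $\tau$ is a proper initial segment of $\sigma$ and $\sigma(|\tau|)=0$, or $\sigma,\tau$ are incomparable and $\sigma$ is lexicographically smaller than $\tau$. For a coloring $f:[\mathbb Q]^2\to k$, an $\ell$-solution to $f$ is a nonempty $S\subseteq\mathbb Q$ that is densely ordered without least or greatest element and satisfies $|f([S]^2)|\le \ell$. $\mathsf{DT}^2_{k,\ell}$ is the statement that every $f:[\mathbb Q]^2\to k$ has an $\ell$-solution. **Theorem.** 1. There is a computable coloring $f:[\mathbb Q]^2\to 4$ such that every $3$-solution to $f$ computes the halting set. (That is, there is a computable instance of $\mathsf{DT}^2_{4,3}$ all of whose solutions compute the halting set.) 2. Such a coloring is obtained explicitly as follows. There is a computable order isomorphism from $(\mathbb Q,<)$ onto $(2^{<\omega},<_{\mathbb Q})$. Let $e$ be any such isomorphism, let $K$ be any complete $\Sigma^0_1$ set,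 and let $(K_s)_{s\in\omega}$ be any computable enumeration of $K$ (a uniformly computable increasing sequence of sets with union $K$). For $\sigma<_{\mathbb Q}\tau$ let $f_{<_{\mathbb Q}}(\sigma,\tau)=1$ if $(|\sigma|<|\tau|\iff\sigma<_{\mathbb Q}\tau)$ and $f_{<_{\mathbb Q}}(\sigma,\tau)=0$ otherwise, and for $x,y,z\in\mathbb N$ let $f_J(x,y,z)=1$ if $K_y\cap\{0,\dots,x-1\}=K_z\cap\{0,\dots,x-1\}$ and $f_J(x,y,z)=0$ otherwise. Then the coloring of $[\mathbb Q]^2$ by the four elements of $\{0,1\}^2$ that gives a pair $p<q$, with $\sigma=e(p)$ and $\tau=e(q)$, the color $\langle f_{<_{\mathbb Q}}(\sigma,\tau),\,f_J(|\sigma\wedge\tau|,|\sigma|,|\tau|)\rangle$ is computable, and every $3$-solution to it computes the halting set. 3. Over $\mathsf{RCA}_0$, $\mathsf{DT}^2_{4,3}$ implies $\mathsf{ACA}_0$: every model $(N,\mathcal S)$ of $\mathsf{RCA}_0$ (with $N$ possibly nonstandard) that satisfies $\mathsf{DT}^2_{4,3}$ is a model of $\mathsf{ACA}_0$. -/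

import Mathlib

universe u

/-! ## Subsets of `ℕ`, Turing reducibility, the halting set -/

/-- The characteristic function of a set of natural numbers, as a (total) partial function. -/
noncomputable def charFun (A : Set ℕ) : ℕ →. ℕ := by
  classical
  exact fun n => Part.some (if n ∈ A then 1 else 0)

/-- `A` is Turing reducible to `B` (that is, `B` computes `A`). -/
def SetTuringReducible (A B : Set ℕ) : Prop :=
  TuringReducible (charFun A) (charFun B)

/-- The halting set: all `e` such that the `e`-th program halts on input `e`. -/
def haltingSet : Set ℕ :=
  {e | ((Denumerable.ofNat Nat.Partrec.Code e).eval e).Dom}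

/-- `K` is a complete `Σ⁰₁` set: it is c.e., and every c.e. set is many-one reducible to it. -/
def IsCompleteSigma1 (K : Set ℕ) : Prop :=
  REPred (fun n => n ∈ K) ∧
    ∀ B : Set ℕ, REPred (fun n => n ∈ B) → ManyOneReducible (fun n => n ∈ B) (fun n => n ∈ K)

/-- `(A s)` is a computable enumeration of `K`: a uniformly computable increasing sequence of sets
with union `K`. (Enumerations by finite sets are a special case.) -/
def IsComputableEnumeration (A : ℕ → Set ℕ) (K : Set ℕ) : Prop :=
  ComputablePred (fun p : ℕ × ℕ => p.2 ∈ A p.1) ∧ Monotone A ∧ ⋃ s, A s = K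

/-! ## Colorings of pairs of rationals -/

/-- The standard code of a rational number: numerator and denominator in lowest terms. -/
def ratCode (q : ℚ) : ℕ := Nat.pair (Encodable.encode q.num) q.den

/-- `S` computes `A`, where `S` is a set of rationals. -/
def RatSetComputes (S : Set ℚ) (A : Set ℕ) : Prop :=
  SetTuringReducible A (ratCode '' S)

/-- A coloring of `[ℚ]²` with `k` colors is given by a function `f`, the color of the pair `{p, q}`
with `p < q` being `f p q`; the values `f p q` for `p ≥ q` play no role. It is computable if the
color can be computed from the codes of `p` and `q`. -/
def IsComputableColoring {k : ℕ} (f : ℚ → ℚ → Fin k) : Prop :=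
  ∃ g : ℕ → ℕ → ℕ, Computable₂ g ∧
    ∀ p q : ℚ, p < q → g (ratCode p) (ratCode q) = (f p q : ℕ)

/-- The set of colors `f([S]²)`. -/
def colorsUsed {k : ℕ} (f : ℚ → ℚ → Fin k) (S : Set ℚ) : Set (Fin k) :=
  {c | ∃ p ∈ S, ∃ q ∈ S, p < q ∧ f p q = c}

/-- `S` is a solution to the instance `f` of Devlin's theorem for pairs with `k` colors and at most
`l` colors in the solution: a (nonempty) dense suborder of `ℚ` without endpoints on whose pairs at
most `l` colors occur. -/
def IsDevlinSolution {k : ℕ} (l : ℕ) (f : ℚ → ℚ → Fin k) (S : Set ℚ) : Prop :=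
  S.Nonempty ∧ DenselyOrdered S ∧ NoMinOrder S ∧ NoMaxOrder S ∧ (colorsUsed f S).ncard ≤ l

/-! ## Binary strings and the product coloring -/

/-- The meet of two binary strings: their longest common initial segment. -/
def meet : List Bool → List Bool → List Bool
  | a :: σ, b :: τ => if a = b then a :: meet σ τ else []
  | _, _ => []

/-- The dense linear order `<_ℚ` on binary strings. -/
def ltQ (σ τ : List Bool) : Prop :=
  (σ <+: τ ∧ τ[σ.length]? = some true) ∨
  (τ <+: σ ∧ σ[τ.length]? = some false) ∨
  (¬ σ <+: τ ∧ ¬ τ <+: σ ∧ σ < τ)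

/-- `e` is a computable isomorphism from `(ℚ, <)` onto the binary strings with `<_ℚ`. -/
def IsComputableStringIso (e : ℚ ≃ List Bool) : Prop :=
  (∀ p q : ℚ, p < q ↔ ltQ (e p) (e q)) ∧
    ∃ g : ℕ → List Bool, Computable g ∧ ∀ q : ℚ, g (ratCode q) = e q

/-- The embedding-type coloring takes the value `1` at `{σ, τ}` iff
`|σ| < |τ| ↔ σ <_ℚ τ`. -/
def EmbeddingTypeOne (σ τ : List Bool) : Prop :=
  σ.length < τ.length ↔ ltQ σ τ

/-- Jockusch's coloring takes the value `1` at `(x, y, z)` iff `A_y` and `A_z` agree below `x`. -/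
def JockuschOne (A : ℕ → Set ℕ) (x y z : ℕ) : Prop :=
  ∀ i < x, i ∈ A y ↔ i ∈ A z

/-- The product of the two colorings above: the color of `{σ, τ}` (with `σ <_ℚ τ`) is the pair of
the embedding-type color and of the Jockusch color of `(|σ ∧ τ|, |σ|, |τ|)`. The pair `⟨a, b⟩` of
elements of `{0, 1}` is written `2 * a + b`. -/
noncomputable def productColoring (A : ℕ → Set ℕ) (σ τ : List Bool) : Fin 4 := by
  classical
  exact (if EmbeddingTypeOne σ τ then 2 else 0) +
    (if JockuschOne A (meet σ τ).length σ.length τ.length then 1 else 0)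

/-! ## Second-order arithmetic -/

/-- Number terms of the language of second-order arithmetic, with number variables `x₀, x₁, …`. -/
inductive NumTerm : Type
  | var (n : ℕ)
  | zero
  | one
  | add (s t : NumTerm)
  | mul (s t : NumTerm)

/-- Arithmetical formulas: the formulas of the language of second-order arithmetic without set
quantifiers (free set variables `X₀, X₁, …` are allowed). Number quantifiers bind de Bruijn index
`0`; in the bounded quantifiers `x < t` the term `t` is outside the scope of the quantifier. -/
inductive ArithFormula : Type
  | eq (s t : NumTerm)
  | lt (s t : NumTerm)
  | mem (t : NumTerm) (X : ℕ)
  | not (φ : ArithFormula)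
  | and (φ ψ : ArithFormula)
  | or (φ ψ : ArithFormula)
  | allLt (t : NumTerm) (φ : ArithFormula)
  | exLt (t : NumTerm) (φ : ArithFormula)
  | all (φ : ArithFormula)
  | ex (φ : ArithFormula)

/-- The `Σ⁰₀` formulas: all quantifiers are bounded. -/
def ArithFormula.IsBounded : ArithFormula → Prop
  | .eq _ _ => True
  | .lt _ _ => True
  | .mem _ _ => True
  | .not φ => φ.IsBounded
  | .and φ ψ => φ.IsBounded ∧ ψ.IsBounded
  | .or φ ψ => φ.IsBounded ∧ ψ.IsBounded
  | .allLt _ φ => φ.IsBounded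
  | .exLt _ φ => φ.IsBounded
  | .all _ => False
  | .ex _ => False

/-- The `Σ⁰₁` formulas `∃ y θ` with `θ` bounded. -/
def ArithFormula.IsSigma1 (φ : ArithFormula) : Prop :=
  ∃ θ : ArithFormula, θ.IsBounded ∧ φ = .ex θ

/-- The `Π⁰₁` formulas `∀ y θ` with `θ` bounded. -/
def ArithFormula.IsPi1 (φ : ArithFormula) : Prop :=
  ∃ θ : ArithFormula, θ.IsBounded ∧ φ = .all θ

/-- The assignment that gives the value `x` to the variable `0` and shifts `v` by one. -/
def consVal {N : Type u} (x : N) (v : ℕ → N) : ℕ → N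
  | 0 => x
  | n + 1 => v n

section Semantics

variable {N : Type u} [CommSemiring N] [LinearOrder N]

def NumTerm.eval (v : ℕ → N) : NumTerm → N
  | .var n => v n
  | .zero => 0
  | .one => 1
  | .add s t => s.eval v + t.eval v
  | .mul s t => s.eval v * t.eval v

/-- Truth of an arithmetical formula under a number assignment `v` and a set assignment `V`. -/
def ArithFormula.Holds (V : ℕ → Set N) : ArithFormula → (ℕ → N) → Prop
  | .eq s t, v => s.eval v = t.eval v
  | .lt s t, v => s.eval v < t.eval v
  | .mem t X, v => t.eval v ∈ V X
  | .not φ, v => ¬ φ.Holds V v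
  | .and φ ψ, v => φ.Holds V v ∧ ψ.Holds V v
  | .or φ ψ, v => φ.Holds V v ∨ ψ.Holds V v
  | .allLt t φ, v => ∀ x : N, x < t.eval v → φ.Holds V (consVal x v)
  | .exLt t φ, v => ∃ x : N, x < t.eval v ∧ φ.Holds V (consVal x v)
  | .all φ, v => ∀ x : N, φ.Holds V (consVal x v)
  | .ex φ, v => ∃ x : N, φ.Holds V (consVal x v)

end Semantics

/-- The axioms of `PA⁻`: `N` is (the nonnegative part of) a discretely ordered ring. Together with
the commutative semiring and linear order axioms these say that the order is compatible with
addition and multiplication, `0 < 1`, `x ≤ y` iff `x + z = y` for some `z`, and there is nothing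
strictly between `0` and `1`. -/
class PAMinus (N : Type u) [CommSemiring N] [LinearOrder N] : Prop
    extends IsStrictOrderedRing N, CanonicallyOrderedAdd N where
  one_le_of_pos : ∀ x : N, 0 < x → 1 ≤ x

section Models

/- A model of second-order arithmetic is a pair `(N, 𝒮)`, where `N` interprets `0, 1, +, ·, <` and
`𝒮` is a collection of subsets of `N`, the range of the set variables. Nonstandard `N` are
allowed. -/

variable {N : Type u} [CommSemiring N] [LinearOrder N]

/-- `(N, 𝒮)` is a model of `RCA₀`: `PA⁻`, `Σ⁰₁` induction and `Δ⁰₁` comprehension, with number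
and set parameters. -/
structure ModelsRCA0 (𝒮 : Set (Set N)) : Prop where
  nonempty : 𝒮.Nonempty
  paMinus : PAMinus N
  sigma1_induction : ∀ φ : ArithFormula, φ.IsSigma1 →
    ∀ (V : ℕ → Set N) (v : ℕ → N), (∀ i, V i ∈ 𝒮) →
      φ.Holds V (consVal 0 v) →
      (∀ x : N, φ.Holds V (consVal x v) → φ.Holds V (consVal (x + 1) v)) →
      ∀ x : N, φ.Holds V (consVal x v)
  delta1_comprehension : ∀ φ ψ : ArithFormula, φ.IsSigma1 → ψ.IsPi1 →
    ∀ (V : ℕ → Set N) (v : ℕ → N), (∀ i, V i ∈ 𝒮) →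
      (∀ x : N, φ.Holds V (consVal x v) ↔ ψ.Holds V (consVal x v)) →
      {x : N | φ.Holds V (consVal x v)} ∈ 𝒮

/-- `(N, 𝒮)` is a model of `ACA₀`: a model of `RCA₀` with comprehension for all arithmetical
formulas. -/
structure ModelsACA0 (𝒮 : Set (Set N)) : Prop where
  rca0 : ModelsRCA0 𝒮
  arithmetical_comprehension : ∀ (φ : ArithFormula) (V : ℕ → Set N) (v : ℕ → N),
    (∀ i, V i ∈ 𝒮) → {x : N | φ.Holds V (consVal x v)} ∈ 𝒮

/-- The usual pairing function of second-order arithmetic. -/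
def pairN (i j : N) : N := (i + j) * (i + j) + i

/-- The code of the fraction `(a - b) / (c + 1)`. -/
def fracCode (a b c : N) : N := pairN (pairN a b) c

/-- `q` is a rational number of the model: rationals are identified with the least codes of
fractions among all codes of fractions of equal value. -/
def IsRatN (q : N) : Prop :=
  ∃ a b c : N, q = fracCode a b c ∧
    ∀ a' b' c' : N, a * (c' + 1) + b' * (c + 1) = a' * (c + 1) + b * (c' + 1) →
      q ≤ fracCode a' b' c'

/-- The order of the rational numbers of the model: `(a - b) / (c + 1) < (a' - b') / (c' + 1)`. -/
def ratLtN (q r : N) : Prop :=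
  ∃ a b c a' b' c' : N, q = fracCode a b c ∧ r = fracCode a' b' c' ∧
    a * (c' + 1) + b' * (c + 1) < a' * (c + 1) + b * (c' + 1)

/-- `F` is (the graph of) a coloring of the pairs of rationals of the model with colors `< k`; the
pair `{p, q}` with `p` less than `q` is coded by `pairN p q`. -/
def IsColoringN (k : ℕ) (F : Set N) : Prop :=
  ∀ p q : N, IsRatN p → IsRatN q → ratLtN p q →
    ∃ c : N, c < (k : N) ∧ ∀ d : N, pairN (pairN p q) d ∈ F ↔ d = c

/-- `S` is a nonempty dense suborder without endpoints of the rationals of the model. -/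
def IsDenseSuborderN (S : Set N) : Prop :=
  (∀ q ∈ S, IsRatN q) ∧ S.Nonempty ∧
    (∀ p ∈ S, ∀ q ∈ S, ratLtN p q → ∃ r ∈ S, ratLtN p r ∧ ratLtN r q) ∧
    (∀ q ∈ S, ∃ p ∈ S, ratLtN p q) ∧ (∀ q ∈ S, ∃ r ∈ S, ratLtN q r)

/-- `(N, 𝒮)` satisfies Devlin's theorem for pairs, `k` colors and at most `l` colors in the
solution: every coloring of the pairs of rationals with `k` colors has a dense suborder without
endpoints on whose pairs at most `l` colors occur. -/
def ModelsDT2 (𝒮 : Set (Set N)) (k l : ℕ) : Prop :=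
  ∀ F ∈ 𝒮, IsColoringN k F →
    ∃ S ∈ 𝒮, IsDenseSuborderN S ∧
      ∃ c : Fin l → N, ∀ p ∈ S, ∀ q ∈ S, ratLtN p q →
        ∀ d : N, pairN (pairN p q) d ∈ F → ∃ i : Fin l, d = c i

end Models

/-!
In a dense suborder `S` of the binary strings every interval contains arbitrarily long strings.
Fix `ρ` in `S`. If `σ <_ℚ ρ <_ℚ τ`, then `|σ ∧ τ| ≤ |ρ|`, so the stages `|σ|` and `|τ|` agree below
`|σ ∧ τ|` as soon as `σ` and `τ` are so long that the enumeration of `K` has settled below `|ρ|`;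
and either of the two can be chosen as the longer one. So both colors with agreeing stages occur in
`S`. If some color is missing, then for one of the two ways in which the lengths of `σ <_ℚ τ` can
be ordered the stages always agree. Say this is so if `|σ| < |τ|`. Moving `τ` towards `σ` makes `τ`
arbitrarily long and the meet no shorter, hence for all `σ <_ℚ τ` in `S` the stage `|σ|` is already
correct below `|σ ∧ τ|`. As pairs with long meets can be found by searching through `S`, it
computes `K`.

In a model of `RCA₀` the codes of rationals take the place of the lengths, and the condition
`i < |σ ∧ τ|` is replaced by the condition that no rational with a code at most `i` lies between
the two given ones, so that no isomorphism with the binary strings is needed. That some stage has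
settled all numbers below a bound is strong `Σ⁰₁` bounding, and that `S` contains arbitrarily close
pairs is shown by `Σ⁰₁` induction. This gives comprehension for all `Σ⁰₁` formulas, which can be
iterated through the number quantifiers of an arithmetical formula.
-/

/-! ## Approximations along a dense order -/

section Core

/-- The pair `⟨a, b⟩` of truth values as a color, written `2 * a + b`. -/
noncomputable def pairColor (a b : Prop) : Fin 4 := by
  classical
  exact (if a then 2 else 0) + (if b then 1 else 0)

theorem pairColor_inj {a b a' b' : Prop} :
    pairColor a b = pairColor a' b' ↔ (a ↔ a') ∧ (b ↔ b') := by
  by_cases a <;> by_cases b <;> by_cases a' <;> by_cases b' <;> simp [pairColor, *]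

theorem exists_pairColor_eq (c : Fin 4) : ∃ a b : Prop, pairColor a b = c := by
  fin_cases c
  exacts [⟨False, False, by simp [pairColor]⟩, ⟨False, True, by simp [pairColor]⟩,
    ⟨True, False, by simp [pairColor]⟩, ⟨True, True, by simp [pairColor]⟩]

variable {α N : Type*} [LinearOrder N]

/-- The stages `size p` and `size q` agree on all relevant numbers `i` for which `p` and `q` are
close. -/
def StagesAgree (size : α → N) (close : N → α → α → Prop) (stage : N → Set N) (p q : α) : Prop :=
  ∀ i < max (size p) (size q), close i p q → (i ∈ stage (size p) ↔ i ∈ stage (size q))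

variable [Preorder α] {size : α → N} {close : N → α → α → Prop} {stage : N → Set N}
  {p q : α} {i : N}

/-- An order in which every interval has elements of arbitrarily large size, together with a notion
`close i p q` that the endpoints `p < q` are so close to each other that nothing of size at most
`i` lies between them. -/
structure IsSizedOrder (size : α → N) (close : N → α → α → Prop) : Prop where
  exists_between : ∀ {p q : α}, p < q → ∀ n : N, ∃ r, p < r ∧ r < q ∧ n < size r
  close_left : ∀ {i : N} {p q r : α}, p < r → r < q → close i p q → close i p r
  close_right : ∀ {i : N} {p q r : α}, p < r → r < q → close i p q → close i r q
  lt_size : ∀ {i : N} {p q r : α}, p < r → r < q → close i p q → i < size r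

namespace IsSizedOrder

open OrderDual

theorem dual (h : IsSizedOrder size close) :
    IsSizedOrder (size ∘ ofDual : αᵒᵈ → N) (fun i p q => close i (ofDual q) (ofDual p)) where
  exists_between hpq n :=
    let ⟨r, hqr, hrp, hn⟩ := h.exists_between hpq n
    ⟨toDual r, hrp, hqr, hn⟩
  close_left hpr hrq := h.close_right hrq hpr
  close_right hpr hrq := h.close_left hrq hpr
  lt_size hpr hrq := h.lt_size hrq hpr

theorem exists_gt [NoMaxOrder α] (h : IsSizedOrder size close) (p : α) (n : N) :
    ∃ r, p < r ∧ n < size r :=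
  let ⟨_, hq⟩ := NoMaxOrder.exists_gt p
  let ⟨r, hpr, _, hn⟩ := h.exists_between hq n
  ⟨r, hpr, hn⟩

theorem mem_stage_left_iff (h : IsSizedOrder size close) (hstage : Monotone stage)
    (hagree : ∀ p r, p < r → size p < size r → StagesAgree size close stage p r)
    (hpq : p < q) (hi : close i p q) : i ∈ stage (size p) ↔ i ∈ ⋃ s, stage s := by
  refine ⟨fun hmem => Set.mem_iUnion_of_mem _ hmem, fun hmem => ?_⟩
  obtain ⟨s, hs⟩ := Set.mem_iUnion.1 hmem
  obtain ⟨r, hpr, hrq, hr⟩ := h.exists_between hpq (max (max s i) (size p))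
  simp only [max_lt_iff] at hr
  exact (hagree p r hpr hr.2 i (lt_max_of_lt_right hr.1.2) (h.close_left hpr hrq hi)).2
    (hstage hr.1.1.le hs)

theorem mem_stage_right_iff (h : IsSizedOrder size close) (hstage : Monotone stage)
    (hagree : ∀ r q, r < q → size q < size r → StagesAgree size close stage r q)
    (hpq : p < q) (hi : close i p q) : i ∈ stage (size q) ↔ i ∈ ⋃ s, stage s :=
  h.dual.mem_stage_left_iff (p := toDual q) (q := toDual p) hstage
    (fun q r hrq hlt j hj hclose =>
      (hagree (ofDual r) (ofDual q) hrq hlt j (max_comm (size (ofDual q)) _ ▸ hj) hclose).symm)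
    hpq hi

variable [Nonempty α] [NoMinOrder α] [NoMaxOrder α]

/-- Once the stage `s` has decided everything below the size of some `ρ`, all stages past `s` agree
on the pairs around `ρ`. -/
theorem exists_stagesAgree (h : IsSizedOrder size close) (hstage : Monotone stage)
    (hbound : ∀ n, ∃ s, ∀ i < n, i ∈ ⋃ t, stage t → i ∈ stage s) :
    ∃ p q, p < q ∧ size p < size q ∧ StagesAgree size close stage p q := by
  obtain ⟨ρ⟩ := ‹Nonempty α›
  obtain ⟨s, hs⟩ := hbound (size ρ)
  obtain ⟨p, hpρ, hsp⟩ : ∃ p, p < ρ ∧ s < size p := h.dual.exists_gt (toDual ρ) s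
  obtain ⟨q, hρq, hpq⟩ := h.exists_gt ρ (size p)
  have decided {i t} (hi : close i p q) (hst : s ≤ t) : i ∈ stage t ↔ i ∈ ⋃ t, stage t :=
    ⟨fun hmem => Set.mem_iUnion_of_mem _ hmem,
      fun hmem => hstage hst (hs i (h.lt_size hpρ hρq hi) hmem)⟩
  exact ⟨p, q, hpρ.trans hρq, hpq, fun i _ hi =>
    (decided hi hsp.le).trans (decided hi (hsp.trans hpq).le).symm⟩

/-- The two colors with agreeing stages always occur. If one of the two others is missing, then
agreement is forced for one of the two ways in which the sizes can be ordered. -/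
theorem mem_stage_left_or_right (h : IsSizedOrder size close) (hstage : Monotone stage)
    (hbound : ∀ n, ∃ s, ∀ i < n, i ∈ ⋃ t, stage t → i ∈ stage s) (c : Fin 4)
    (hc : ∀ p q, p < q → pairColor (size p < size q) (StagesAgree size close stage p q) ≠ c) :
    (∀ i p q, p < q → close i p q → (i ∈ stage (size p) ↔ i ∈ ⋃ s, stage s)) ∨
      ∀ i p q, p < q → close i p q → (i ∈ stage (size q) ↔ i ∈ ⋃ s, stage s) := by
  obtain ⟨a, b, rfl⟩ := exists_pairColor_eq c
  simp only [ne_eq, pairColor_inj] at hc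
  have hb : ¬b := by
    intro hb
    by_cases ha : a
    · obtain ⟨p, q, hpq, hlt, hagree⟩ := h.exists_stagesAgree hstage hbound
      exact hc p q hpq ⟨iff_of_true hlt ha, iff_of_true hagree hb⟩
    · obtain ⟨q, p, hpq, hlt, hagree⟩ := h.dual.exists_stagesAgree hstage hbound
      refine hc (ofDual p) (ofDual q) hpq ⟨iff_of_false hlt.not_gt ha, iff_of_true ?_ hb⟩
      exact fun i hi hclose => (hagree i (max_comm (size (ofDual p)) _ ▸ hi) hclose).symm
  have agree {p q : α} (hpq : p < q) (ha : size p < size q ↔ a) :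
      StagesAgree size close stage p q :=
    of_not_not fun hnot => hc p q hpq ⟨ha, iff_of_false hnot hb⟩
  by_cases ha : a
  · exact .inl fun i p q => h.mem_stage_left_iff hstage fun p r hpr hlt =>
      agree hpr (iff_of_true hlt ha)
  · exact .inr fun i p q => h.mem_stage_right_iff hstage fun r q hrq hlt =>
      agree hrq (iff_of_false hlt.not_gt ha)

end IsSizedOrder

end Core

/-! ## Binary strings -/

section Strings

@[simp] theorem ltQ_nil_left {τ : List Bool} : ltQ [] τ ↔ τ[0]? = some true := by
  simp [ltQ]

@[simp] theorem ltQ_nil_right {σ : List Bool} : ltQ σ [] ↔ σ[0]? = some false := by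
  simp [ltQ]

@[simp] theorem ltQ_cons_cons {a b : Bool} {σ τ : List Bool} :
    ltQ (a :: σ) (b :: τ) ↔ a < b ∨ a = b ∧ ltQ σ τ := by
  by_cases hab : a = b
  · simp [ltQ, hab, List.cons_prefix_cons]
  · simp [ltQ, hab, Ne.symm hab, List.cons_prefix_cons, List.cons_lt_cons_iff]

theorem ltQ_iff_getElem?_meet {σ τ : List Bool} :
    ltQ σ τ ↔ σ[(meet σ τ).length]? = some false ∨
      (σ[(meet σ τ).length]? = none ∧ τ[(meet σ τ).length]? = some true) := by
  induction σ generalizing τ with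
  | nil => simp [meet]
  | cons a σ ih =>
    cases τ with
    | nil => simp [meet]
    | cons b τ =>
      by_cases hab : a = b
      · simp [meet, hab, ih]
      · cases a <;> cases b <;> simp_all [meet]

theorem le_meet_length_iff {σ τ : List Bool} {k : ℕ} :
    k ≤ (meet σ τ).length ↔ k ≤ σ.length ∧ k ≤ τ.length ∧ σ.take k = τ.take k := by
  induction σ generalizing τ k with
  | nil => cases k <;> simp [meet]
  | cons a σ ih =>
    rcases τ with _ | ⟨b, τ⟩ <;> rcases k with _ | k <;> simp only [meet] <;> try simp
    split_ifs with h <;> simp [ih, h]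

theorem meet_length_le_left (σ τ : List Bool) : (meet σ τ).length ≤ σ.length :=
  (le_meet_length_iff.1 le_rfl).1

theorem meet_length_le_right (σ τ : List Bool) : (meet σ τ).length ≤ τ.length :=
  (le_meet_length_iff.1 le_rfl).2.1

theorem meet_length_le_of_ltQ_of_ltQ {σ ρ τ : List Bool} (hσρ : ltQ σ ρ) (hρτ : ltQ ρ τ) :
    (meet σ τ).length ≤ (meet σ ρ).length ∧ (meet σ τ).length ≤ (meet ρ τ).length := by
  induction σ generalizing ρ τ with
  | nil => simp [meet]
  | cons a σ ih =>
    rcases τ with _ | ⟨b, τ⟩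
    · simp [meet]
    by_cases hab : a = b
    · subst hab
      rcases ρ with _ | ⟨c, ρ⟩
      · simp_all
      · have hac : a = c := by cases a <;> cases c <;> simp_all [Bool.lt_iff]
        subst hac
        simpa [meet] using ih (by simpa using hσρ) (by simpa using hρτ)
    · simp [meet, hab]

theorem infinite_exists_lt_length {T : Set (List Bool)} (hT : T.Infinite) (n : ℕ) :
    ∃ σ ∈ T, n < σ.length := by
  obtain ⟨σ, hσ, hlong⟩ := hT.exists_notMem_finite (List.finite_length_le Bool n)
  exact ⟨σ, hσ, not_le.1 hlong⟩

theorem infinite_exists_lt_meet_length {T : Set (List Bool)} (hT : T.Infinite) (n : ℕ) :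
    ∃ σ ∈ T, ∃ τ ∈ T, σ ≠ τ ∧ n < (meet σ τ).length := by
  have hmaps : Set.MapsTo (List.take (n + 1)) (T \ {σ | σ.length ≤ n})
      {σ : List Bool | σ.length ≤ n + 1} := fun σ _ => by simp
  obtain ⟨σ, ⟨hσ, hσn⟩, τ, ⟨hτ, hτn⟩, hne, htake⟩ :=
    (hT.sdiff (List.finite_length_le Bool n)).exists_ne_map_eq_of_mapsTo hmaps
      (List.finite_length_le Bool (n + 1))
  exact ⟨σ, hσ, τ, hτ, hne,
    le_meet_length_iff.2 ⟨Nat.lt_of_not_ge hσn, Nat.lt_of_not_ge hτn, htake⟩⟩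

theorem isSizedOrder_length {α : Type*} [Preorder α] [DenselyOrdered α] {e : α → List Bool}
    (hinj : Function.Injective e) (hlt : ∀ p q, p < q → ltQ (e p) (e q)) :
    IsSizedOrder (fun p => (e p).length) fun i p q => i < (meet (e p) (e q)).length where
  exists_between {p q} hpq n := by
    obtain ⟨_, ⟨r, ⟨hpr, hrq⟩, rfl⟩, hr⟩ :=
      infinite_exists_lt_length ((Set.Ioo_infinite hpq).image hinj.injOn) n
    exact ⟨r, hpr, hrq, hr⟩
  close_left hpr hrq hi :=
    hi.trans_le (meet_length_le_of_ltQ_of_ltQ (hlt _ _ hpr) (hlt _ _ hrq)).1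
  close_right hpr hrq hi :=
    hi.trans_le (meet_length_le_of_ltQ_of_ltQ (hlt _ _ hpr) (hlt _ _ hrq)).2
  lt_size hpr hrq hi :=
    (hi.trans_le (meet_length_le_of_ltQ_of_ltQ (hlt _ _ hpr) (hlt _ _ hrq)).1).trans_le
      (meet_length_le_right _ _)

end Strings

/-! ## Solutions of the product coloring -/

section ProductColoring

variable {A : ℕ → Set ℕ}

theorem productColoring_eq_pairColor {σ τ : List Bool} (h : ltQ σ τ) :
    productColoring A σ τ = pairColor (σ.length < τ.length)
      (JockuschOne A (meet σ τ).length σ.length τ.length) := by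
  simp [productColoring, pairColor, EmbeddingTypeOne, h]

theorem jockuschOne_meet_iff {α : Type*} {e : α → List Bool} {p q : α} :
    JockuschOne A (meet (e p) (e q)).length (e p).length (e q).length ↔
      StagesAgree (fun p => (e p).length) (fun i p q => i < (meet (e p) (e q)).length) A p q :=
  ⟨fun h i _ hi => h i hi, fun h i hi =>
    h i (lt_max_of_lt_left (hi.trans_le (meet_length_le_left _ _))) hi⟩

theorem exists_forall_lt_mem (hA : Monotone A) (n : ℕ) :
    ∃ s, ∀ i < n, i ∈ ⋃ t, A t → i ∈ A s := by
  obtain ⟨T, hT⟩ := ((Set.finite_Iio n).inter_of_left (⋃ t, A t)).exists_finset_coe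
  obtain ⟨s, hs⟩ := hA.directed_le.exists_mem_subset_of_finset_subset_biUnion
    (hT ▸ Set.inter_subset_right)
  exact ⟨s, fun i hi hmem => hs (hT ▸ ⟨hi, hmem⟩)⟩

theorem exists_ne_of_ncard_lt {k : ℕ} {C : Set (Fin k)} (hC : C.ncard < k) : ∃ c, c ∉ C := by
  by_contra! hall
  simp [Set.eq_univ_of_forall hall] at hC

theorem IsDevlinSolution.mem_stage_left_or_right {e : ℚ ≃ List Bool} {S : Set ℚ}
    (he : ∀ p q, p < q ↔ ltQ (e p) (e q)) (hA : Monotone A)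
    (hS : IsDevlinSolution 3 (fun p q => productColoring A (e p) (e q)) S) :
    (∀ i, ∀ p ∈ S, ∀ q ∈ S, p < q → i < (meet (e p) (e q)).length →
      (i ∈ A (e p).length ↔ i ∈ ⋃ s, A s)) ∨
    ∀ i, ∀ p ∈ S, ∀ q ∈ S, p < q → i < (meet (e p) (e q)).length →
      (i ∈ A (e q).length ↔ i ∈ ⋃ s, A s) := by
  obtain ⟨hne, _, _, _, hcard⟩ := hS
  have := hne.to_subtype
  have hsized := isSizedOrder_length (e := fun p : S => e p)
    (e.injective.comp Subtype.val_injective) fun p q => (he p q).1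
  obtain ⟨c, hc⟩ := exists_ne_of_ncard_lt (Nat.lt_succ_of_le hcard)
  have hmissing (p q : S) (hpq : p < q) : pairColor ((e p).length < (e q).length)
      (StagesAgree (fun p : S => (e p).length) (fun i p q => i < (meet (e p) (e q)).length) A p q)
        ≠ c := by
    rintro rfl
    refine hc ⟨p, p.2, q, q.2, hpq, ?_⟩
    rw [← jockuschOne_meet_iff]
    exact productColoring_eq_pairColor ((he p q).1 hpq)
  exact (hsized.mem_stage_left_or_right hA (exists_forall_lt_mem hA) c hmissing).imp
    (fun h i p hp q hq => h i ⟨p, hp⟩ ⟨q, hq⟩) fun h i p hp q hq => h i ⟨p, hp⟩ ⟨q, hq⟩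

theorem IsDevlinSolution.exists_lt_meet_length {k l : ℕ} {f : ℚ → ℚ → Fin k} {S : Set ℚ}
    (hS : IsDevlinSolution l f S) (e : ℚ ≃ List Bool) (n : ℕ) :
    ∃ p ∈ S, ∃ q ∈ S, p < q ∧ n < (meet (e p) (e q)).length := by
  obtain ⟨hne, _, _, _, -⟩ := hS
  have := hne.to_subtype
  have hinf : (e '' S).Infinite :=
    (Set.infinite_coe_iff.1 (NoMaxOrder.infinite (α := S))).image e.injective.injOn
  obtain ⟨_, ⟨p, hp, rfl⟩, _, ⟨q, hq, rfl⟩, hne, hn⟩ := infinite_exists_lt_meet_length hinf n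
  rcases lt_or_gt_of_ne (fun h => hne (congrArg e h) : p ≠ q) with hpq | hqp
  · exact ⟨p, hp, q, hq, hpq, hn⟩
  · obtain ⟨hp', hq', htake⟩ := le_meet_length_iff.1 hn
    exact ⟨q, hq, p, hp, hqp, le_meet_length_iff.2 ⟨hq', hp', htake.symm⟩⟩

end ProductColoring

/-! ## Computability -/

section RelativeComputability

variable {O : Set (ℕ →. ℕ)} {f g : ℕ → ℕ} {A B : Set ℕ}

theorem computableIn_comp (hf : ComputableIn O f) (hg : ComputableIn O g) :
    ComputableIn O fun n => f (g n) :=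
  RecursiveIn.iff_nat.2 <| ((RecursiveIn.iff_nat.1 hf).comp (RecursiveIn.iff_nat.1 hg)).of_eq
    fun n => by simp

theorem computableIn_natPair (hf : ComputableIn O f) (hg : ComputableIn O g) :
    ComputableIn O fun n => Nat.pair (f n) (g n) :=
  RecursiveIn.iff_nat.2 <| ((RecursiveIn.iff_nat.1 hf).pair (RecursiveIn.iff_nat.1 hg)).of_eq
    fun n => by simp [Seq.seq]

theorem computableIn_find (hf : ComputableIn O f) (hex : ∀ n, ∃ m, f (Nat.pair n m) = 0) :
    ComputableIn O fun n => Nat.find (hex n) := by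
  refine RecursiveIn.iff_nat.2 <| (Nat.RecursiveIn.rfind (RecursiveIn.iff_nat.1 hf)).of_eq
    fun n => Part.eq_some_iff.2 (Nat.mem_rfind.2 ⟨?_, fun hm => ?_⟩)
  · simpa using Nat.find_spec (hex n)
  · simpa using Nat.find_min (hex n) hm

theorem charFun_eq_indicator (A : Set ℕ) :
    charFun A = fun n => Part.some (A.indicator (1 : ℕ → ℕ) n) := by
  classical
  funext n
  simp only [charFun, Set.indicator_apply, Pi.one_apply]

theorem setTuringReducible_iff :
    SetTuringReducible A B ↔ ComputableIn {charFun B} (A.indicator (1 : ℕ → ℕ)) := by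
  rw [SetTuringReducible, charFun_eq_indicator A]
  rfl

theorem computableIn_indicator (B : Set ℕ) : ComputableIn {charFun B} (B.indicator (1 : ℕ → ℕ)) :=
  setTuringReducible_iff.1 (TuringReducible.refl _)

theorem setTuringReducible_unpair_mem (B : Set ℕ) :
    SetTuringReducible {m | m.unpair.1 ∈ B ∧ m.unpair.2 ∈ B} B := by
  have hmem {g : ℕ → ℕ} (hg : Computable g) :
      ComputableIn {charFun B} fun m => B.indicator (1 : ℕ → ℕ) (g m) :=
    computableIn_comp (computableIn_indicator B) hg.computableIn
  have hmul : Computable fun k : ℕ => k.unpair.1 * k.unpair.2 :=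
    Primrec.nat_mul.to_comp.comp (Computable.fst.comp .unpair) (Computable.snd.comp .unpair)
  have hprod := computableIn_comp hmul.computableIn <| computableIn_natPair
    (hmem (Computable.fst.comp .unpair)) (hmem (Computable.snd.comp .unpair))
  refine setTuringReducible_iff.2 (Eq.subst (funext fun m => ?_) hprod)
  by_cases h₁ : m.unpair.1 ∈ B <;> by_cases h₂ : m.unpair.2 ∈ B <;> simp [h₁, h₂]

theorem setTuringReducible_of_search {T D : ℕ → ℕ → Prop}
    (hT : ComputablePred fun p : ℕ × ℕ => T p.1 p.2)
    (hD : ComputablePred fun p : ℕ × ℕ => D p.1 p.2)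
    (hex : ∀ n, ∃ m ∈ B, T n m) (hcorrect : ∀ n, ∀ m ∈ B, T n m → (D n m ↔ n ∈ A)) :
    SetTuringReducible A B := by
  classical
  let search : ℕ → ℕ := fun k => cond (decide (T k.unpair.1.unpair.1 k.unpair.1.unpair.2))
    (1 - k.unpair.2) 1
  have hsearch : Computable search :=
    Computable.cond (hT.decide.comp (Computable.unpair.comp (Computable.fst.comp .unpair)))
      (Primrec.nat_sub.to_comp.comp (.const 1) (Computable.snd.comp .unpair)) (.const 1)
  let test : ℕ → ℕ := fun k => search (Nat.pair k (B.indicator 1 k.unpair.2))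
  have htest : ComputableIn {charFun B} test :=
    computableIn_comp hsearch.computableIn <| computableIn_natPair ComputableIn.id <|
      computableIn_comp (computableIn_indicator B) (Computable.snd.comp .unpair).computableIn
  have test_eq_zero {n m : ℕ} : test (Nat.pair n m) = 0 ↔ m ∈ B ∧ T n m := by
    by_cases hm : m ∈ B <;> by_cases hnm : T n m <;> simp [test, search, hm, hnm]
  have hfound : ∀ n, ∃ m, test (Nat.pair n m) = 0 := by simpa only [test_eq_zero] using hex
  let answer : ℕ → ℕ := fun k => cond (decide (D k.unpair.1 k.unpair.2)) 1 0
  have hanswer : Computable answer :=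
    Computable.cond (hD.decide.comp .unpair) (.const 1) (.const 0)
  refine setTuringReducible_iff.2 (Eq.subst (funext fun n => ?_) <| computableIn_comp
    hanswer.computableIn (computableIn_natPair ComputableIn.id (computableIn_find htest hfound)))
  obtain ⟨hm, hnm⟩ := test_eq_zero.1 (Nat.find_spec (hfound n))
  by_cases hn : n ∈ A <;> simp [answer, hcorrect n _ hm hnm, hn]

end RelativeComputability

section HaltingSet

open Nat.Partrec (Code)

theorem rePred_mem_haltingSet : REPred fun n => n ∈ haltingSet :=
  (Code.eval_part.comp (Computable.ofNat Code) Computable.id).dom_re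

theorem isCompleteSigma1_haltingSet : IsCompleteSigma1 haltingSet := by
  refine ⟨rePred_mem_haltingSet, fun B hB => ?_⟩
  have hdom : Nat.Partrec fun k : ℕ =>
      (Part.assert (k.unpair.1 ∈ B) fun _ => Part.some ()).map fun _ => 0 :=
    Partrec.nat_iff.1 <| Partrec.map
      (Partrec.comp hB (Computable.fst.comp Computable.unpair)) (Computable.const 0).to₂
  obtain ⟨c, hc⟩ := Code.exists_code.1 hdom
  refine ⟨fun n => Encodable.encode (c.curry n), ?_, fun n => ?_⟩
  · exact Computable.encode.comp
      (Code.primrec₂_curry.to_comp.comp (Computable.const c) Computable.id)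
  · simp [haltingSet, Code.eval_curry, hc, Part.assert]

/-- The programs that halt on their own code within `s` steps: the usual enumeration of the halting
set. -/
def haltingStage (s : ℕ) : Set ℕ :=
  {n | (Code.evaln s (Denumerable.ofNat Code n) n).isSome = true}

theorem isComputableEnumeration_haltingStage :
    IsComputableEnumeration haltingStage haltingSet := by
  refine ⟨?_, fun s t hst n hn => ?_, ?_⟩
  · have hevaln : Primrec fun p : ℕ × ℕ => Code.evaln p.1 (Denumerable.ofNat Code p.2) p.2 :=
      Code.primrec_evaln.comp
        ((Primrec.fst.pair ((Primrec.ofNat Code).comp Primrec.snd)).pair Primrec.snd)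
    exact ComputablePred.computable_iff.2 ⟨_, (Primrec.option_isSome.comp hevaln).to_comp, rfl⟩
  · obtain ⟨x, hx⟩ := Option.isSome_iff_exists.1 hn
    exact Option.isSome_iff_exists.2 ⟨x, Code.evaln_mono hst hx⟩
  · ext n
    simp only [Set.mem_iUnion, haltingStage, haltingSet, Set.mem_ofPred_eq, Part.dom_iff_mem,
      Code.evaln_complete, Option.isSome_iff_exists]
    exact exists_comm

end HaltingSet

section ComputablePredicates

variable {α β : Type*} [Primcodable α] [Primcodable β] {P Q : α → Prop}

theorem computablePred_comp {f : β → α} (hP : ComputablePred P) (hf : Computable f) :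
    ComputablePred fun b => P (f b) :=
  ComputablePred.computable_of_manyOneReducible (ManyOneReducible.mk P hf) hP

theorem computablePred_and (hP : ComputablePred P) (hQ : ComputablePred Q) :
    ComputablePred fun a => P a ∧ Q a := by
  classical
  exact ((Primrec.and.to_comp.comp hP.decide hQ.decide).of_eq fun a => by simp).computablePred

theorem computablePred_iff (hP : ComputablePred P) (hQ : ComputablePred Q) :
    ComputablePred fun a => P a ↔ Q a := by
  classical
  exact ((Primrec.beq.to_comp.comp hP.decide hQ.decide).of_eq fun a => by simp).computablePred

theorem computablePred_forall_lt {R : α → ℕ → Prop}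
    (hR : ComputablePred fun p : α × ℕ => R p.1 p.2) :
    ComputablePred fun p : α × ℕ => ∀ i < p.2, R p.1 i := by
  classical
  have hstep : Computable₂ fun (p : α × ℕ) (r : ℕ × Bool) => r.2 && decide (R p.1 r.1) :=
    Primrec.and.to_comp.comp (Computable.snd.comp .snd)
      (hR.decide.comp ((Computable.fst.comp .fst).pair (Computable.fst.comp .snd)))
  refine ((Computable.nat_rec .snd (.const true) hstep).of_eq fun p => ?_).computablePred
  obtain ⟨a, n⟩ := p
  induction n with
  | zero => simp
  | succ n ih => simp_all only [Nat.forall_lt_succ_right, Bool.decide_and]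

end ComputablePredicates

section ComputableStrings

theorem computable_meet_length : Computable₂ fun σ τ : List Bool => (meet σ τ).length := by
  have hfind : Primrec fun p : List Bool × List Bool =>
      p.1.length.findGreatest fun k => k ≤ p.2.length ∧ p.1.take k = p.2.take k := by
    refine Primrec.nat_findGreatest (Primrec.list_length.comp .fst) (PrimrecPred.and ?_ ?_)
    · exact Primrec.nat_le.comp .snd (Primrec.list_length.comp (Primrec.snd.comp .fst))
    · exact Primrec.eq.comp (Primrec.list_take.comp .snd (Primrec.fst.comp .fst))
        (Primrec.list_take.comp .snd (Primrec.snd.comp .fst))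
  refine hfind.to_comp.of_eq fun ⟨σ, τ⟩ => ?_
  obtain ⟨hσ, hτ⟩ := le_meet_length_iff.1 (le_refl (meet σ τ).length)
  exact Nat.findGreatest_eq_iff.2 ⟨hσ, fun _ => hτ, fun k hk hkσ hkτ =>
    (le_meet_length_iff.2 ⟨hkσ, hkτ⟩).not_gt hk⟩

theorem computablePred_ltQ : ComputablePred fun p : List Bool × List Bool => ltQ p.1 p.2 := by
  let f : Option Bool × Option Bool → Bool := fun q =>
    decide (q.1 = some false ∨ (q.1 = none ∧ q.2 = some true))
  have hf : Computable f := (Primrec.dom_finite f).to_comp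
  have hdigits := (Primrec.list_getElem?.to_comp.comp .fst computable_meet_length).pair
    (Primrec.list_getElem?.to_comp.comp .snd computable_meet_length)
  refine ComputablePred.computable_iff.2 ⟨_, hf.comp hdigits, funext fun p => ?_⟩
  simp only [f, decide_eq_true_eq, ltQ_iff_getElem?_meet]

theorem computablePred_jockuschOne {A : ℕ → Set ℕ}
    (hA : ComputablePred fun p : ℕ × ℕ => p.2 ∈ A p.1) :
    ComputablePred fun p : (ℕ × ℕ) × ℕ => JockuschOne A p.2 p.1.1 p.1.2 :=
  computablePred_forall_lt (R := fun (p : ℕ × ℕ) i => i ∈ A p.1 ↔ i ∈ A p.2) <| computablePred_iff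
    (computablePred_comp hA ((Computable.fst.comp .fst).pair .snd))
    (computablePred_comp hA ((Computable.snd.comp .fst).pair .snd))

end ComputableStrings

section ComputableColoring

variable {e : ℚ ≃ List Bool} {A : ℕ → Set ℕ} {K : Set ℕ}

theorem pairColor_val (a b : Prop) [Decidable a] [Decidable b] :
    (pairColor a b : ℕ) = cond (decide a) 2 0 + cond (decide b) 1 0 := by
  by_cases a <;> by_cases b <;> simp [pairColor, *]

theorem IsComputableStringIso.isComputableColoring (he : IsComputableStringIso e)
    (hA : ComputablePred fun p : ℕ × ℕ => p.2 ∈ A p.1) :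
    IsComputableColoring fun p q => productColoring A (e p) (e q) := by
  classical
  obtain ⟨hlt, g, hg, hge⟩ := he
  let size : ℕ → ℕ := fun m => (g m).length
  have hsize : Computable size := Computable.list_length.comp hg
  have hsizes : Computable fun p : ℕ × ℕ => (size p.1, size p.2) :=
    (hsize.comp .fst).pair (hsize.comp .snd)
  have hmeet : Computable fun p : ℕ × ℕ => (meet (g p.1) (g p.2)).length :=
    computable_meet_length.comp (hg.comp .fst) (hg.comp .snd)
  have hless : ComputablePred fun p : ℕ × ℕ => size p.1 < size p.2 :=
    computablePred_comp (Primrec.nat_lt.computablePred) hsizes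
  have hagree : ComputablePred fun p : ℕ × ℕ =>
      JockuschOne A (meet (g p.1) (g p.2)).length (size p.1) (size p.2) :=
    computablePred_comp (computablePred_jockuschOne hA) (hsizes.pair hmeet)
  refine ⟨fun m n => pairColor (size m < size n)
    (JockuschOne A (meet (g m) (g n)).length (size m) (size n)), ?_, fun p q hpq => ?_⟩
  · simp only [pairColor_val]
    exact Primrec.nat_add.to_comp.comp (hless.decide.cond (.const 2) (.const 0))
      (hagree.decide.cond (.const 1) (.const 0))
  · simp only [size, hge, productColoring_eq_pairColor ((hlt p q).1 hpq)]

/-- A stage that is correct below the length of the meet can be read off from any pair of elements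
of `S` with a long meet, and such pairs are found by searching. -/
theorem ratSetComputes_of_correct_stage (he : IsComputableStringIso e)
    (hA : ComputablePred fun p : ℕ × ℕ => p.2 ∈ A p.1) {S : Set ℚ}
    (hlong : ∀ n, ∃ p ∈ S, ∃ q ∈ S, p < q ∧ n < (meet (e p) (e q)).length)
    {size : List Bool → List Bool → ℕ} (hsize : Computable₂ size)
    (hcorrect : ∀ i, ∀ p ∈ S, ∀ q ∈ S, p < q → i < (meet (e p) (e q)).length →
      (i ∈ A (size (e p) (e q)) ↔ i ∈ K)) {B : Set ℕ}
    (hB : ManyOneReducible (fun n => n ∈ B) fun n => n ∈ K) : RatSetComputes S B := by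
  obtain ⟨hlt, g, hg, hge⟩ := he
  obtain ⟨f, hf, hfK⟩ := hB
  have hf' : Computable fun p : ℕ × ℕ => f p.1 := hf.comp .fst
  let strings : ℕ → List Bool × List Bool := fun m => (g m.unpair.1, g m.unpair.2)
  have hstrings : Computable fun p : ℕ × ℕ => strings p.2 :=
    ((hg.comp (Computable.fst.comp .unpair)).pair
      (hg.comp (Computable.snd.comp .unpair))).comp .snd
  refine TuringReducible.trans (setTuringReducible_of_search
      (T := fun n m => ltQ (strings m).1 (strings m).2 ∧
        f n < (meet (strings m).1 (strings m).2).length)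
      (D := fun n m => f n ∈ A (size (strings m).1 (strings m).2)) ?_ ?_ (fun n => ?_) ?_)
    (setTuringReducible_unpair_mem (ratCode '' S))
  · exact computablePred_and (computablePred_comp computablePred_ltQ hstrings)
      (computablePred_comp Primrec.nat_lt.computablePred
        (hf'.pair (Computable.comp computable_meet_length hstrings)))
  · exact computablePred_comp hA ((Computable.comp hsize hstrings).pair hf')
  · obtain ⟨p, hp, q, hq, hpq, hn⟩ := hlong (f n)
    refine ⟨Nat.pair (ratCode p) (ratCode q), ?_, ?_⟩
    · simpa using ⟨⟨p, hp, rfl⟩, q, hq, rfl⟩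
    · simpa [strings, hge, ← hlt] using ⟨hpq, hn⟩
  · rintro n m ⟨⟨p, hp, hpm⟩, q, hq, hqm⟩
    simp only [strings, ← hpm, ← hqm, hge, ← hlt]
    exact fun ⟨hpq, hn⟩ => (hcorrect _ p hp q hq hpq hn).trans (hfK n).symm

theorem IsDevlinSolution.ratSetComputes_haltingSet (he : IsComputableStringIso e)
    (hK : IsCompleteSigma1 K) (hA : IsComputableEnumeration A K) {S : Set ℚ}
    (hS : IsDevlinSolution 3 (fun p q => productColoring A (e p) (e q)) S) :
    RatSetComputes S haltingSet := by
  obtain ⟨hdec, hmono, rfl⟩ := hA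
  have hreduce := hK.2 _ rePred_mem_haltingSet
  have hlong := hS.exists_lt_meet_length e
  rcases hS.mem_stage_left_or_right he.1 hmono with hleft | hright
  · exact ratSetComputes_of_correct_stage he hdec hlong
      (size := fun σ _ => σ.length) (Computable.list_length.comp .fst) hleft hreduce
  · exact ratSetComputes_of_correct_stage he hdec hlong
      (size := fun _ τ => τ.length) (Computable.list_length.comp .snd) hright hreduce

end ComputableColoring

/-! ## Binary strings as rational numbers -/

section SternBrocot

/-- The positive rational at a node of the Stern–Brocot tree. -/
def sternBrocot : List Bool → ℚ
  | [] => 1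
  | true :: σ => sternBrocot σ + 1
  | false :: σ => sternBrocot σ / (sternBrocot σ + 1)

theorem sternBrocot_pos (σ : List Bool) : 0 < sternBrocot σ := by
  induction σ with
  | nil => exact one_pos
  | cons b σ ih => cases b <;> simp only [sternBrocot] <;> positivity

theorem sternBrocot_false_lt_one (σ : List Bool) : sternBrocot (false :: σ) < 1 := by
  have := sternBrocot_pos σ
  rw [sternBrocot, div_lt_one (by positivity)]
  exact lt_add_one _

theorem one_lt_sternBrocot_true (σ : List Bool) : 1 < sternBrocot (true :: σ) :=
  lt_add_of_pos_left _ (sternBrocot_pos σ)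

theorem ltQ_iff_sternBrocot_lt {σ τ : List Bool} : ltQ σ τ ↔ sternBrocot σ < sternBrocot τ := by
  induction σ generalizing τ with
  | nil =>
    match τ with
    | [] => simp
    | true :: τ => simpa [sternBrocot.eq_1] using one_lt_sternBrocot_true τ
    | false :: τ => simpa [sternBrocot.eq_1] using (sternBrocot_false_lt_one τ).le
  | cons a σ ih =>
    match a, τ with
    | true, [] => simpa [sternBrocot.eq_1] using (one_lt_sternBrocot_true σ).le
    | false, [] => simpa [sternBrocot.eq_1] using sternBrocot_false_lt_one σ
    | true, true :: τ => simp [sternBrocot, ih]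
    | true, false :: τ =>
      simpa [Bool.lt_iff] using ((sternBrocot_false_lt_one τ).trans (one_lt_sternBrocot_true σ)).le
    | false, true :: τ =>
      simpa using (sternBrocot_false_lt_one σ).trans (one_lt_sternBrocot_true τ)
    | false, false :: τ =>
      have hσ := sternBrocot_pos σ
      have hτ := sternBrocot_pos τ
      simp only [ltQ_cons_cons, sternBrocot, ih, true_and, lt_irrefl, false_or]
      rw [div_lt_div_iff₀ (by positivity) (by positivity)]
      constructor <;> intro h <;> linarith

theorem ltQ_trichotomy (σ τ : List Bool) : ltQ σ τ ∨ σ = τ ∨ ltQ τ σ := by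
  induction σ generalizing τ with
  | nil => rcases τ with _ | ⟨_ | _, τ⟩ <;> simp
  | cons a σ ih =>
    rcases τ with _ | ⟨b, τ⟩
    · cases a <;> simp
    · cases a <;> cases b <;> simp [ih]

/-- An order isomorphism from the binary strings onto `ℚ`: the root goes to `0`, and the two
subtrees below it are copies of the Stern–Brocot tree of positive rationals, the left one reflected
by `x ↦ -x⁻¹` to the negative rationals. -/
def stringRat : List Bool → ℚ
  | [] => 0
  | true :: σ => sternBrocot σ
  | false :: σ => -(sternBrocot σ)⁻¹

theorem ltQ_iff_stringRat_lt {σ τ : List Bool} : ltQ σ τ ↔ stringRat σ < stringRat τ := by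
  have hneg (ρ : List Bool) : -(sternBrocot ρ)⁻¹ < 0 := by simpa using sternBrocot_pos ρ
  rcases σ with _ | ⟨_ | _, σ⟩ <;> rcases τ with _ | ⟨_ | _, τ⟩
  · simp
  · simpa [stringRat] using (sternBrocot_pos τ).le
  · simpa [stringRat] using sternBrocot_pos τ
  · simpa [stringRat] using sternBrocot_pos σ
  · simp [stringRat, ← ltQ_iff_sternBrocot_lt, inv_lt_inv₀, sternBrocot_pos]
  · simpa [stringRat] using (hneg σ).trans (sternBrocot_pos τ)
  · simpa [stringRat] using (sternBrocot_pos σ).le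
  · simpa [stringRat, Bool.lt_iff] using ((hneg τ).trans (sternBrocot_pos σ)).le
  · simp [stringRat, ← ltQ_iff_sternBrocot_lt]

theorem stringRat_injective : Function.Injective stringRat := fun σ τ h => by
  rcases ltQ_trichotomy σ τ with hlt | heq | hgt
  · exact absurd h (ltQ_iff_stringRat_lt.1 hlt).ne
  · exact heq
  · exact absurd h (ltQ_iff_stringRat_lt.1 hgt).ne'

/-- The path to `a / b` in the Stern–Brocot tree, found by the subtractive Euclidean algorithm and
cut off after `n` steps. -/
def sternBrocotPath : ℕ → ℕ → ℕ → List Bool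
  | 0, _, _ => []
  | n + 1, a, b =>
    if a < b then false :: sternBrocotPath n a (b - a)
    else if b < a then true :: sternBrocotPath n (a - b) b
    else []

theorem sternBrocot_sternBrocotPath {n a b : ℕ} (ha : 0 < a) (hb : 0 < b) (h : a + b ≤ n) :
    sternBrocot (sternBrocotPath n a b) = a / b := by
  induction n generalizing a b with
  | zero => omega
  | succ n ih =>
    have hb' : (b : ℚ) ≠ 0 := by positivity
    simp only [sternBrocotPath]
    split_ifs with hab hba
    · have hne : (b : ℚ) - a ≠ 0 := sub_ne_zero.2 (by exact_mod_cast hab.ne')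
      have hsum : (a : ℚ) / (b - a) + 1 = b / (b - a) := by field_simp; ring
      rw [sternBrocot, ih ha (by omega) (by omega), Nat.cast_sub hab.le, hsum]
      field_simp
    · rw [sternBrocot, ih (by omega) hb (by omega), Nat.cast_sub hba.le]
      field_simp
      ring
    · obtain rfl : a = b := by omega
      simp [sternBrocot, hb']

/-- One step of the computation of `sternBrocotPath` with an accumulator, so that the path becomes
an iterate. -/
def sternBrocotStep (s : ℕ × ℕ × List Bool) : ℕ × ℕ × List Bool :=
  if s.1 < s.2.1 then (s.1, s.2.1 - s.1, s.2.2 ++ [false])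
  else if s.2.1 < s.1 then (s.1 - s.2.1, s.2.1, s.2.2 ++ [true])
  else s

theorem sternBrocotStep_iterate (n a b : ℕ) (l : List Bool) :
    (sternBrocotStep^[n] (a, b, l)).2.2 = l ++ sternBrocotPath n a b := by
  induction n generalizing a b l with
  | zero => simp [sternBrocotPath]
  | succ n ih =>
    rw [Function.iterate_succ_apply]
    by_cases hab : a < b
    · rw [sternBrocotStep, if_pos hab, ih]
      simp [sternBrocotPath, hab]
    · by_cases hba : b < a
      · rw [sternBrocotStep, if_neg hab, if_pos hba, ih]
        simp [sternBrocotPath, hab, hba]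
      · rw [sternBrocotStep, if_neg hab, if_neg hba, ih]
        cases n <;> simp [sternBrocotPath, hab, hba]

theorem primrec_sternBrocotPath :
    Primrec fun p : ℕ × ℕ × ℕ => sternBrocotPath p.1 p.2.1 p.2.2 := by
  have ha : Primrec fun s : ℕ × ℕ × List Bool => s.1 := Primrec.fst
  have hb : Primrec fun s : ℕ × ℕ × List Bool => s.2.1 := Primrec.fst.comp Primrec.snd
  have hl : Primrec fun s : ℕ × ℕ × List Bool => s.2.2 := Primrec.snd.comp Primrec.snd
  have hstep : Primrec sternBrocotStep :=
    Primrec.ite (Primrec.nat_lt.comp ha hb)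
      (ha.pair ((Primrec.nat_sub.comp hb ha).pair (Primrec.list_append.comp hl (Primrec.const _))))
      (Primrec.ite (Primrec.nat_lt.comp hb ha) ((Primrec.nat_sub.comp ha hb).pair
        (hb.pair (Primrec.list_append.comp hl (Primrec.const _)))) Primrec.id)
  have hinit : Primrec fun p : ℕ × ℕ × ℕ => (p.2.1, p.2.2, ([] : List Bool)) :=
    (Primrec.fst.comp Primrec.snd).pair
      ((Primrec.snd.comp Primrec.snd).pair (Primrec.const []))
  refine (hl.comp (Primrec.nat_iterate Primrec.fst hinit
    (hstep.comp Primrec.snd).to₂)).of_eq fun p => ?_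
  rw [sternBrocotStep_iterate, List.nil_append]

theorem encode_int (k : ℤ) :
    Encodable.encode k = if 0 ≤ k then 2 * k.natAbs else 2 * k.natAbs - 1 := by
  cases k with
  | ofNat n => simp; rfl
  | negSucc n => exact (if_neg (by simp)).symm

/-- The inverse of `stringRat` on codes of rationals: a numerator `n ≥ 0` is coded by `2 * n`, a
numerator `-n < 0` by `2 * n - 1`. -/
def codeString (c : ℕ) : List Bool :=
  let n := (c.unpair.1 + 1) / 2
  let d := c.unpair.2
  if c.unpair.1 = 0 then []
  else if c.unpair.1 % 2 = 0 then true :: sternBrocotPath (n + d) n d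
  else false :: sternBrocotPath (d + n) d n

theorem primrec_codeString : Primrec codeString := by
  have hcode : Primrec fun c : ℕ => c.unpair.1 := Primrec.fst.comp Primrec.unpair
  have hn : Primrec fun c : ℕ => (c.unpair.1 + 1) / 2 :=
    Primrec.nat_div.comp (Primrec.succ.comp hcode) (Primrec.const 2)
  have hd : Primrec fun c : ℕ => c.unpair.2 := Primrec.snd.comp Primrec.unpair
  exact Primrec.ite (Primrec.eq.comp hcode (Primrec.const 0)) (Primrec.const [])
    (Primrec.ite (Primrec.eq.comp (Primrec.nat_mod.comp hcode (Primrec.const 2)) (Primrec.const 0))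
      (Primrec.list_cons.comp (Primrec.const true) (primrec_sternBrocotPath.comp
        ((Primrec.nat_add.comp hn hd).pair (hn.pair hd))))
      (Primrec.list_cons.comp (Primrec.const false) (primrec_sternBrocotPath.comp
        ((Primrec.nat_add.comp hd hn).pair (hd.pair hn)))))

theorem stringRat_codeString (q : ℚ) : stringRat (codeString (ratCode q)) = q := by
  have hq : (q.num / q.den : ℚ) = q := Rat.num_div_den q
  rcases lt_trichotomy q.num 0 with hneg | hzero | hpos
  · have hn : (2 * q.num.natAbs - 1 + 1) / 2 = q.num.natAbs := by omega
    have habs : ((q.num.natAbs : ℕ) : ℚ) = -q.num := by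
      rw [Nat.cast_natAbs, abs_of_neg hneg, Int.cast_neg]
    simp only [codeString, ratCode, Nat.unpair_pair, encode_int, if_neg hneg.not_ge, hn,
      if_neg (show 2 * q.num.natAbs - 1 ≠ 0 by omega),
      if_neg (show (2 * q.num.natAbs - 1) % 2 ≠ 0 by omega), stringRat]
    rw [sternBrocot_sternBrocotPath q.den_pos (by omega) le_rfl, inv_div, habs, neg_div, neg_neg,
      hq]
  · simp [codeString, ratCode, encode_int, stringRat, Rat.num_eq_zero.1 hzero]
  · have hn : (2 * q.num.natAbs + 1) / 2 = q.num.natAbs := by omega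
    have habs : ((q.num.natAbs : ℕ) : ℚ) = q.num := by
      rw [Nat.cast_natAbs, abs_of_pos hpos]
    simp only [codeString, ratCode, Nat.unpair_pair, encode_int, if_pos hpos.le, hn,
      if_neg (show 2 * q.num.natAbs ≠ 0 by omega), Nat.mul_mod_right, if_true, stringRat]
    rw [sternBrocot_sternBrocotPath (by omega) q.den_pos le_rfl, habs, hq]

theorem exists_isComputableStringIso : ∃ e : ℚ ≃ List Bool, IsComputableStringIso e := by
  let e := Equiv.ofBijective stringRat
    ⟨stringRat_injective, fun q => ⟨codeString (ratCode q), stringRat_codeString q⟩⟩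
  have he (q : ℚ) : stringRat (e.symm q) = q := e.apply_symm_apply q
  refine ⟨e.symm, fun p q => ?_, codeString, primrec_codeString.to_comp, fun q =>
    stringRat_injective ((stringRat_codeString q).trans (he q).symm)⟩
  rw [ltQ_iff_stringRat_lt, he, he]

end SternBrocot

/-! ## Models of `PA⁻` -/

section Arithmetic

variable {N : Type u} [CommSemiring N] [LinearOrder N] [PAMinus N]

theorem PAMinus.lt_add_one_iff {x y : N} : x < y + 1 ↔ x ≤ y := by
  refine ⟨fun h => ?_, fun h => h.trans_lt (lt_add_one y)⟩
  by_contra! hlt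
  obtain ⟨z, rfl⟩ := le_iff_exists_add.1 hlt.le
  exact h.not_ge (add_le_add_right (PAMinus.one_le_of_pos z (pos_of_lt_add_right hlt)) y)

theorem PAMinus.add_one_le_iff {x y : N} : x + 1 ≤ y ↔ x < y := by
  rw [← not_lt, PAMinus.lt_add_one_iff, not_le]

theorem PAMinus.le_mul_self (x : N) : x ≤ x * x := by
  rcases (zero_le (a := x)).eq_or_lt with rfl | hx
  · simp
  · exact le_mul_of_one_le_left hx.le (PAMinus.one_le_of_pos x hx)

theorem PAMinus.add_one_pos (x : N) : 0 < x + 1 :=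
  PAMinus.lt_add_one_iff.2 zero_le

theorem le_pairN_left (i j : N) : i ≤ pairN i j := le_add_self

theorem le_pairN_right (i j : N) : j ≤ pairN i j :=
  (le_add_self.trans (PAMinus.le_mul_self (i + j))).trans le_self_add

theorem pairN_lt_of_add_lt {i j i' j' : N} (h : i + j < i' + j') : pairN i j < pairN i' j' :=
  calc
    pairN i j < pairN i j + (i + j + j + 1) := by
      simpa only [lt_add_iff_pos_right] using PAMinus.add_one_pos _
    _ = (i + j + 1) * (i + j + 1) := by unfold pairN; ring
    _ ≤ (i' + j') * (i' + j') := mul_self_le_mul_self zero_le (PAMinus.add_one_le_iff.2 h)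
    _ ≤ pairN i' j' := le_self_add

theorem pairN_inj {i j i' j' : N} : pairN i j = pairN i' j' ↔ i = i' ∧ j = j' := by
  refine ⟨fun h => ?_, fun ⟨hi, hj⟩ => hi ▸ hj ▸ rfl⟩
  have hadd : i + j = i' + j' := by
    by_contra hne
    rcases lt_or_gt_of_ne hne with hlt | hlt
    exacts [(pairN_lt_of_add_lt hlt).ne h, (pairN_lt_of_add_lt hlt).ne' h]
  have hi : i = i' := by
    unfold pairN at h
    exact add_left_cancel (hadd ▸ h)
  exact ⟨hi, add_left_cancel (hi ▸ hadd)⟩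

theorem fracCode_inj {a b c a' b' c' : N} :
    fracCode a b c = fracCode a' b' c' ↔ a = a' ∧ b = b' ∧ c = c' := by
  simp only [fracCode, pairN_inj, and_assoc]

theorem ratLtN.asymm {p q : N} (h : ratLtN p q) : ¬ratLtN q p := by
  rintro ⟨a, b, c, a', b', c', rfl, rfl, hba⟩
  obtain ⟨_, _, _, _, _, _, hp, hq, hab⟩ := h
  obtain ⟨rfl, rfl, rfl⟩ := fracCode_inj.1 hp
  obtain ⟨rfl, rfl, rfl⟩ := fracCode_inj.1 hq
  exact lt_asymm hba hab

theorem ratLtN.trans {p q r : N} (hpq : ratLtN p q) (hqr : ratLtN q r) : ratLtN p r := by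
  obtain ⟨a, b, c, a', b', c', rfl, rfl, hlt⟩ := hpq
  obtain ⟨_, _, _, a'', b'', c'', hq, rfl, hlt'⟩ := hqr
  obtain ⟨rfl, rfl, rfl⟩ := fracCode_inj.1 hq
  refine ⟨a, b, c, a'', b'', c'', rfl, rfl, ?_⟩
  refine lt_of_mul_lt_mul_right (a := c' + 1) ?_ zero_le
  refine lt_of_add_lt_add_right (a := a' * (c + 1) * (c'' + 1) + b' * (c + 1) * (c'' + 1)) ?_
  convert add_lt_add (mul_lt_mul_of_pos_right hlt (PAMinus.add_one_pos c''))
    (mul_lt_mul_of_pos_right hlt' (PAMinus.add_one_pos c)) using 1 <;> ring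

end Arithmetic

/-! ## Bounded definitions -/

section BoundedDef

variable {N : Type u} [CommSemiring N]

/-- The polynomials, with parameters, in the entries of a sequence of numbers. -/
inductive PolyFun : ((ℕ → N) → N) → Prop
  | var (i : ℕ) : PolyFun fun v => v i
  | const (c : N) : PolyFun fun _ => c
  | add {s t} (hs : PolyFun s) (ht : PolyFun t) : PolyFun fun v => s v + t v
  | mul {s t} (hs : PolyFun s) (ht : PolyFun t) : PolyFun fun v => s v * t v

variable {s t : (ℕ → N) → N} {σ : (ℕ → N) → ℕ → N}

namespace PolyFun

theorem pairN (hs : PolyFun s) (ht : PolyFun t) : PolyFun fun v => pairN (s v) (t v) :=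
  ((hs.add ht).mul (hs.add ht)).add hs

theorem subst (ht : PolyFun t) (hσ : ∀ i, PolyFun fun v => σ v i) : PolyFun fun v => t (σ v) := by
  induction ht with
  | var i => exact hσ i
  | const c => exact .const c
  | add _ _ ihs iht => exact ihs.add iht
  | mul _ _ ihs iht => exact ihs.mul iht

theorem shift (ht : PolyFun t) : PolyFun fun w => t fun i => w (i + 1) :=
  ht.subst fun i => .var (i + 1)

end PolyFun

variable [LinearOrder N]

/-- The predicates on sequences of numbers that are defined by `Σ⁰₀` formulas with number
parameters and set parameters from `𝒮`. In the clause for quantifiers the bound variable is the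
entry `0` of the sequence. -/
inductive BoundedDef (𝒮 : Set (Set N)) : ((ℕ → N) → Prop) → Prop
  | lt {s t : (ℕ → N) → N} (hs : PolyFun s) (ht : PolyFun t) : BoundedDef 𝒮 fun v => s v < t v
  | mem {A : Set N} {t : (ℕ → N) → N} (hA : A ∈ 𝒮) (ht : PolyFun t) : BoundedDef 𝒮 fun v => t v ∈ A
  | not {P} (hP : BoundedDef 𝒮 P) : BoundedDef 𝒮 fun v => ¬P v
  | and {P Q} (hP : BoundedDef 𝒮 P) (hQ : BoundedDef 𝒮 Q) : BoundedDef 𝒮 fun v => P v ∧ Q v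
  | exLt {R : N → (ℕ → N) → Prop} {t : (ℕ → N) → N} (ht : PolyFun t)
      (hR : BoundedDef 𝒮 fun w => R (w 0) fun i => w (i + 1)) :
      BoundedDef 𝒮 fun v => ∃ x < t v, R x v

/-- A binary relation with a bounded definition. -/
def BoundedRel (𝒮 : Set (Set N)) (R : N → N → Prop) : Prop :=
  BoundedDef 𝒮 fun v => R (v 0) (v 1)

variable {𝒮 : Set (Set N)} {P Q : (ℕ → N) → Prop}

namespace BoundedDef

theorem congr (hP : BoundedDef 𝒮 P) (hPQ : ∀ v, Q v ↔ P v) : BoundedDef 𝒮 Q := by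
  rwa [show Q = P from funext fun v => propext (hPQ v)]

theorem subst (hP : BoundedDef 𝒮 P) (hσ : ∀ i, PolyFun fun v => σ v i) :
    BoundedDef 𝒮 fun v => P (σ v) := by
  induction hP generalizing σ with
  | lt hs ht => exact .lt (hs.subst hσ) (ht.subst hσ)
  | mem hA ht => exact .mem hA (ht.subst hσ)
  | not _ ih => exact .not (ih hσ)
  | and _ _ ihP ihQ => exact .and (ihP hσ) (ihQ hσ)
  | exLt ht _ ih =>
    refine .exLt (ht.subst hσ) (ih (σ := fun w => consVal (w 0) (σ fun i => w (i + 1))) ?_)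
    rintro (_ | i)
    exacts [.var 0, (hσ i).shift]

theorem or (hP : BoundedDef 𝒮 P) (hQ : BoundedDef 𝒮 Q) : BoundedDef 𝒮 fun v => P v ∨ Q v :=
  (hP.not.and hQ.not).not.congr fun v => by tauto

theorem imp (hP : BoundedDef 𝒮 P) (hQ : BoundedDef 𝒮 Q) : BoundedDef 𝒮 fun v => P v → Q v :=
  (hP.and hQ.not).not.congr fun v => by tauto

theorem iff (hP : BoundedDef 𝒮 P) (hQ : BoundedDef 𝒮 Q) : BoundedDef 𝒮 fun v => P v ↔ Q v :=
  ((hP.imp hQ).and (hQ.imp hP)).congr fun v => by tauto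

theorem eq (hs : PolyFun s) (ht : PolyFun t) : BoundedDef 𝒮 fun v => s v = t v :=
  ((lt hs ht).not.and (lt ht hs).not).congr fun v => by
    rw [not_lt, not_lt, and_comm, le_antisymm_iff]

theorem allLt {R : N → (ℕ → N) → Prop} (ht : PolyFun t)
    (hR : BoundedDef 𝒮 fun w => R (w 0) fun i => w (i + 1)) :
    BoundedDef 𝒮 fun v => ∀ x < t v, R x v :=
  (exLt (R := fun x v => ¬R x v) ht hR.not).not.congr fun v => by push Not; rfl

variable [PAMinus N]

theorem exLe {R : N → (ℕ → N) → Prop} (ht : PolyFun t)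
    (hR : BoundedDef 𝒮 fun w => R (w 0) fun i => w (i + 1)) :
    BoundedDef 𝒮 fun v => ∃ x ≤ t v, R x v :=
  (exLt (ht.add (.const 1)) hR).congr fun v => by simp only [PAMinus.lt_add_one_iff]

theorem allLe {R : N → (ℕ → N) → Prop} (ht : PolyFun t)
    (hR : BoundedDef 𝒮 fun w => R (w 0) fun i => w (i + 1)) :
    BoundedDef 𝒮 fun v => ∀ x ≤ t v, R x v :=
  (allLt (ht.add (.const 1)) hR).congr fun v => by simp only [PAMinus.lt_add_one_iff]

/-- The components of a pair are bounded by its code. -/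
theorem exists_pairN {R : N → N → (ℕ → N) → Prop} (ht : PolyFun t)
    (hR : BoundedDef 𝒮 fun w => R (w 1) (w 0) fun i => w (i + 2)) :
    BoundedDef 𝒮 fun v => ∃ a b, t v = _root_.pairN a b ∧ R a b v := by
  refine (exLe (R := fun a v => ∃ b ≤ t v, t v = _root_.pairN a b ∧ R a b v) ht
    (exLe (R := fun b v => t (fun i => v (i + 1)) = _root_.pairN (v 0) b ∧
      R (v 0) b fun i => v (i + 1)) ht.shift
      (.and (.eq ht.shift.shift (.pairN (.var 1) (.var 0))) hR))).congr fun v => ⟨?_, ?_⟩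
  · rintro ⟨a, b, heq, hR⟩
    exact ⟨a, heq ▸ le_pairN_left a b, b, heq ▸ le_pairN_right a b, heq, hR⟩
  · rintro ⟨a, -, b, -, heq, hR⟩
    exact ⟨a, b, heq, hR⟩

end BoundedDef

theorem BoundedRel.comp {R : N → N → Prop} (hR : BoundedRel 𝒮 R) (hs : PolyFun s)
    (ht : PolyFun t) : BoundedDef 𝒮 fun v => R (s v) (t v) := by
  refine BoundedDef.subst (σ := fun v => consVal (s v) fun _ => t v) hR ?_
  rintro (_ | _)
  exacts [hs, ht]

end BoundedDef

/-! ## Bounded definitions and formulas -/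

section Rename

/-- The sequence `f 0, g 0, f 1, g 1, …`. -/
def interleave {α : Type*} (f g : ℕ → α) : ℕ → α :=
  Sum.elim f g ∘ Equiv.natSumNatEquivNat.symm

/-- The positions of the first of two interleaved sequences. -/
def evenPos : ℕ → ℕ := Equiv.natSumNatEquivNat ∘ Sum.inl

/-- The positions of the second of two interleaved sequences. -/
def oddPos : ℕ → ℕ := Equiv.natSumNatEquivNat ∘ Sum.inr

theorem interleave_comp_evenPos {α : Type*} (f g : ℕ → α) : interleave f g ∘ evenPos = f := by
  funext i
  simp [interleave, evenPos]

theorem interleave_comp_oddPos {α : Type*} (f g : ℕ → α) : interleave f g ∘ oddPos = g := by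
  funext i
  simp [interleave, oddPos]

theorem interleave_mem {α : Type*} {𝒮 : Set α} {f g : ℕ → α} (hf : ∀ i, f i ∈ 𝒮)
    (hg : ∀ i, g i ∈ 𝒮) (i : ℕ) : interleave f g i ∈ 𝒮 := by
  unfold interleave
  rcases h : Equiv.natSumNatEquivNat.symm i with j | j <;> simp [h, hf, hg]

/-- A renaming of variables under one binder. -/
def liftVar (ρ : ℕ → ℕ) : ℕ → ℕ
  | 0 => 0
  | n + 1 => ρ n + 1

variable {N : Type u}

theorem consVal_comp_liftVar (x : N) (v : ℕ → N) (ρ : ℕ → ℕ) :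
    consVal x v ∘ liftVar ρ = consVal x (v ∘ ρ) := by
  funext i
  cases i <;> rfl

/-- The values of variables each of which is either an entry of the sequence `v` or a parameter. -/
def assign (f : ℕ → ℕ ⊕ N) (v : ℕ → N) : ℕ → N := Sum.elim v id ∘ f

theorem exists_assign_consVal_eq (f : ℕ → ℕ ⊕ N) :
    ∃ (ρ : ℕ → ℕ) (g : ℕ → ℕ ⊕ N), ∀ (x : N) (v : ℕ → N),
      assign f (consVal x v) = consVal x (assign g v) ∘ ρ := by
  classical
  refine ⟨fun i => if f i = .inl 0 then 0 else i + 1, fun i => Sum.map Nat.pred id (f i),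
    fun x v => funext fun i => ?_⟩
  rcases h : f i with (_ | n) | c <;> simp [assign, consVal, h]

theorem assign_interleave_comp_evenPos (f g : ℕ → ℕ ⊕ N) (v : ℕ → N) :
    assign (interleave f g) v ∘ evenPos = assign f v := by
  rw [assign, Function.comp_assoc, interleave_comp_evenPos, assign]

theorem assign_interleave_comp_oddPos (f g : ℕ → ℕ ⊕ N) (v : ℕ → N) :
    assign (interleave f g) v ∘ oddPos = assign g v := by
  rw [assign, Function.comp_assoc, interleave_comp_oddPos, assign]

/-- Renaming of the variables of a term by `ρ`. -/
def NumTerm.rename (ρ : ℕ → ℕ) : NumTerm → NumTerm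
  | .var n => .var (ρ n)
  | .zero => .zero
  | .one => .one
  | .add s t => .add (s.rename ρ) (t.rename ρ)
  | .mul s t => .mul (s.rename ρ) (t.rename ρ)

/-- Renaming of the set variables by `κ` and of the free number variables by `ρ`. -/
def ArithFormula.rename (κ : ℕ → ℕ) : (ℕ → ℕ) → ArithFormula → ArithFormula
  | ρ, .eq s t => .eq (s.rename ρ) (t.rename ρ)
  | ρ, .lt s t => .lt (s.rename ρ) (t.rename ρ)
  | ρ, .mem t X => .mem (t.rename ρ) (κ X)
  | ρ, .not φ => .not (φ.rename κ ρ)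
  | ρ, .and φ ψ => .and (φ.rename κ ρ) (ψ.rename κ ρ)
  | ρ, .or φ ψ => .or (φ.rename κ ρ) (ψ.rename κ ρ)
  | ρ, .allLt t φ => .allLt (t.rename ρ) (φ.rename κ (liftVar ρ))
  | ρ, .exLt t φ => .exLt (t.rename ρ) (φ.rename κ (liftVar ρ))
  | ρ, .all φ => .all (φ.rename κ (liftVar ρ))
  | ρ, .ex φ => .ex (φ.rename κ (liftVar ρ))

theorem ArithFormula.IsBounded.rename {φ : ArithFormula} (h : φ.IsBounded) (κ ρ : ℕ → ℕ) :
    (φ.rename κ ρ).IsBounded := by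
  induction φ generalizing ρ with
  | eq | lt | mem => trivial
  | not φ ih => exact ih h ρ
  | and φ ψ ih ih' | or φ ψ ih ih' => exact ⟨ih h.1 ρ, ih' h.2 ρ⟩
  | allLt t φ ih | exLt t φ ih => exact ih h _
  | all | ex => exact h.elim

variable [CommSemiring N]

theorem NumTerm.eval_rename (t : NumTerm) (ρ : ℕ → ℕ) (v : ℕ → N) :
    (t.rename ρ).eval v = t.eval (v ∘ ρ) := by
  induction t with
  | var | zero | one => rfl
  | add s t ihs iht | mul s t ihs iht => simp only [NumTerm.rename, NumTerm.eval, ihs, iht]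

theorem ArithFormula.holds_rename [LinearOrder N] (φ : ArithFormula) (κ ρ : ℕ → ℕ)
    (V : ℕ → Set N) (v : ℕ → N) : (φ.rename κ ρ).Holds V v ↔ φ.Holds (V ∘ κ) (v ∘ ρ) := by
  induction φ generalizing ρ v with
  | eq | lt | mem => simp only [rename, Holds, NumTerm.eval_rename, Function.comp_apply]
  | not φ ih => simp only [rename, Holds, ih]
  | and φ ψ ih ih' | or φ ψ ih ih' => simp only [rename, Holds, ih, ih']
  | allLt t φ ih | exLt t φ ih =>
    simp only [rename, Holds, ih, NumTerm.eval_rename, consVal_comp_liftVar]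
  | all φ ih | ex φ ih => simp only [rename, Holds, ih, consVal_comp_liftVar]

end Rename

section Translation

variable {N : Type u} [CommSemiring N]

theorem PolyFun.exists_eval {t : (ℕ → N) → N} (ht : PolyFun t) :
    ∃ (τ : NumTerm) (f : ℕ → ℕ ⊕ N), ∀ v, t v = τ.eval (assign f v) := by
  induction ht with
  | var i => exact ⟨.var 0, fun _ => .inl i, fun v => rfl⟩
  | const c => exact ⟨.var 0, fun _ => .inr c, fun v => rfl⟩
  | add _ _ ihs iht =>
    obtain ⟨σ, f, hσ⟩ := ihs
    obtain ⟨τ, g, hτ⟩ := iht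
    refine ⟨.add (σ.rename evenPos) (τ.rename oddPos), interleave f g, fun v => ?_⟩
    simp only [NumTerm.eval, NumTerm.eval_rename, assign_interleave_comp_evenPos,
      assign_interleave_comp_oddPos, hσ, hτ]
  | mul _ _ ihs iht =>
    obtain ⟨σ, f, hσ⟩ := ihs
    obtain ⟨τ, g, hτ⟩ := iht
    refine ⟨.mul (σ.rename evenPos) (τ.rename oddPos), interleave f g, fun v => ?_⟩
    simp only [NumTerm.eval, NumTerm.eval_rename, assign_interleave_comp_evenPos,
      assign_interleave_comp_oddPos, hσ, hτ]

variable [LinearOrder N] {𝒮 : Set (Set N)} {P : (ℕ → N) → Prop} {R Q : N → N → Prop}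

theorem BoundedDef.exists_holds (h𝒮 : 𝒮.Nonempty) (hP : BoundedDef 𝒮 P) :
    ∃ (θ : ArithFormula) (V : ℕ → Set N) (f : ℕ → ℕ ⊕ N), θ.IsBounded ∧ (∀ i, V i ∈ 𝒮) ∧
      ∀ v, P v ↔ θ.Holds V (assign f v) := by
  induction hP with
  | lt hs ht =>
    obtain ⟨A, hA⟩ := h𝒮
    obtain ⟨σ, f, hσ⟩ := hs.exists_eval
    obtain ⟨τ, g, hτ⟩ := ht.exists_eval
    refine ⟨.lt (σ.rename evenPos) (τ.rename oddPos), fun _ => A, interleave f g, trivial,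
      fun _ => hA, fun v => ?_⟩
    simp only [ArithFormula.Holds, NumTerm.eval_rename, assign_interleave_comp_evenPos,
      assign_interleave_comp_oddPos, hσ, hτ]
  | mem hA ht =>
    obtain ⟨τ, f, hτ⟩ := ht.exists_eval
    exact ⟨.mem τ 0, fun _ => _, f, trivial, fun _ => hA, fun v => by
      simp only [ArithFormula.Holds, hτ]⟩
  | not _ ih =>
    obtain ⟨θ, V, f, hθ, hV, h⟩ := ih
    exact ⟨.not θ, V, f, hθ, hV, fun v => not_congr (h v)⟩
  | and _ _ ihP ihQ =>
    obtain ⟨θ, V, f, hθ, hV, hP⟩ := ihP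
    obtain ⟨η, W, g, hη, hW, hQ⟩ := ihQ
    refine ⟨.and (θ.rename evenPos evenPos) (η.rename oddPos oddPos), interleave V W,
      interleave f g, ⟨hθ.rename _ _, hη.rename _ _⟩, interleave_mem hV hW, fun v => ?_⟩
    simp only [ArithFormula.Holds, ArithFormula.holds_rename, interleave_comp_evenPos,
      interleave_comp_oddPos, assign_interleave_comp_evenPos, assign_interleave_comp_oddPos, hP, hQ]
  | exLt ht _ ih =>
    obtain ⟨τ, f, hτ⟩ := ht.exists_eval
    obtain ⟨θ, V, g, hθ, hV, hR⟩ := ih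
    obtain ⟨ρ, g', hρ⟩ := exists_assign_consVal_eq g
    refine ⟨.exLt (τ.rename evenPos) (θ.rename id (liftVar oddPos ∘ ρ)), V, interleave f g',
      hθ.rename _ _, hV, fun v => ?_⟩
    simp only [ArithFormula.Holds, ArithFormula.holds_rename, NumTerm.eval_rename, hτ,
      assign_interleave_comp_evenPos, ← Function.comp_assoc, consVal_comp_liftVar,
      assign_interleave_comp_oddPos, ← hρ, Function.comp_id, ← hR]
    rfl

theorem BoundedRel.exists_holds (h𝒮 : 𝒮.Nonempty) (hR : BoundedRel 𝒮 R) :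
    ∃ (θ : ArithFormula) (V : ℕ → Set N) (u : ℕ → N), θ.IsBounded ∧ (∀ i, V i ∈ 𝒮) ∧
      ∀ y x, R y x ↔ θ.Holds V (consVal y (consVal x u)) := by
  obtain ⟨θ, V, f, hθ, hV, h⟩ := BoundedDef.exists_holds h𝒮 hR
  obtain ⟨ρ, f', hρ⟩ := exists_assign_consVal_eq f
  obtain ⟨ρ', f'', hρ'⟩ := exists_assign_consVal_eq f'
  refine ⟨θ.rename id (liftVar ρ' ∘ ρ), V, assign f'' fun _ => 0, hθ.rename _ _, hV, fun y x => ?_⟩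
  rw [ArithFormula.holds_rename, ← Function.comp_assoc, consVal_comp_liftVar, ← hρ', ← hρ,
    Function.comp_id, ← h]
  rfl

theorem BoundedRel.exists_holds₂ (h𝒮 : 𝒮.Nonempty) (hR : BoundedRel 𝒮 R) (hQ : BoundedRel 𝒮 Q) :
    ∃ (θ η : ArithFormula) (V : ℕ → Set N) (u : ℕ → N), θ.IsBounded ∧ η.IsBounded ∧
      (∀ i, V i ∈ 𝒮) ∧ (∀ y x, R y x ↔ θ.Holds V (consVal y (consVal x u))) ∧
      ∀ y x, Q y x ↔ η.Holds V (consVal y (consVal x u)) := by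
  obtain ⟨θ, V, u, hθ, hV, hR⟩ := hR.exists_holds h𝒮
  obtain ⟨η, W, w, hη, hW, hQ⟩ := hQ.exists_holds h𝒮
  refine ⟨θ.rename evenPos (liftVar (liftVar evenPos)), η.rename oddPos (liftVar (liftVar oddPos)),
    interleave V W, interleave u w, hθ.rename _ _, hη.rename _ _, interleave_mem hV hW, ?_, ?_⟩ <;>
  · intro y x
    simp only [ArithFormula.holds_rename, consVal_comp_liftVar, interleave_comp_evenPos,
      interleave_comp_oddPos, hR, hQ]

namespace ModelsRCA0

variable (hM : ModelsRCA0 𝒮)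
include hM

theorem induction (hR : BoundedRel 𝒮 R) (zero : ∃ y, R y 0)
    (succ : ∀ x, (∃ y, R y x) → ∃ y, R y (x + 1)) (x : N) : ∃ y, R y x := by
  obtain ⟨θ, V, u, hθ, hV, h⟩ := hR.exists_holds hM.nonempty
  simp only [h] at zero succ ⊢
  exact hM.sigma1_induction (.ex θ) ⟨θ, hθ, rfl⟩ V u hV zero succ x

theorem delta_comprehension (hR : BoundedRel 𝒮 R) (hQ : BoundedRel 𝒮 Q)
    (hRQ : ∀ x, (∃ y, R y x) ↔ ∀ y, Q y x) : {x | ∃ y, R y x} ∈ 𝒮 := by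
  obtain ⟨θ, η, V, u, hθ, hη, hV, hR, hQ⟩ := hR.exists_holds₂ hM.nonempty hQ
  simp only [hR, hQ] at hRQ ⊢
  exact hM.delta1_comprehension (.ex θ) (.all η) ⟨θ, hθ, rfl⟩ ⟨η, hη, rfl⟩ V u hV hRQ

theorem bounded_comprehension {P : N → Prop} (hP : BoundedDef 𝒮 fun v => P (v 0)) :
    {x | P x} ∈ 𝒮 := by
  have hR : BoundedRel 𝒮 fun _ x => P x :=
    hP.subst (σ := fun v _ => v 1) fun _ => .var 1
  simpa only [exists_const] using
    hM.delta_comprehension hR hR fun x => by rw [exists_const, forall_const]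

end ModelsRCA0

end Translation

/-! ## Strong bounding -/

section Divisibility

theorem dvd_right_of_dvd_add {M : Type*} [CommSemiring M] [LinearOrder M] [IsStrictOrderedRing M]
    [CanonicallyOrderedAdd M] {a b c : M} (hb : a ∣ b) (h : a ∣ b + c) : a ∣ c := by
  obtain ⟨b', rfl⟩ := hb
  obtain ⟨d, hd⟩ := h
  rcases (zero_le (a := a)).eq_or_lt with rfl | ha
  · simp_all
  · obtain ⟨e, rfl⟩ := le_iff_exists_add.1 (le_of_mul_le_mul_left (hd ▸ le_self_add) ha : b' ≤ d)
    exact ⟨e, add_left_cancel (hd.trans (mul_add a b' e))⟩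

variable {N : Type u} [CommSemiring N] [LinearOrder N]

theorem PAMinus.dvd_iff_exists_le [PAMinus N] {a b : N} : a ∣ b ↔ ∃ k ≤ b, b = a * k := by
  refine ⟨?_, fun ⟨k, _, hk⟩ => ⟨k, hk⟩⟩
  rintro ⟨k, rfl⟩
  rcases (zero_le (a := a)).eq_or_lt with rfl | ha
  · exact ⟨0, zero_le, by simp⟩
  · exact ⟨k, le_mul_of_one_le_left zero_le (PAMinus.one_le_of_pos a ha), rfl⟩

theorem BoundedDef.dvd [PAMinus N] {𝒮 : Set (Set N)} {s t : (ℕ → N) → N} (hs : PolyFun s)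
    (ht : PolyFun t) : BoundedDef 𝒮 fun v => s v ∣ t v :=
  (exLe ht (.eq ht.shift (hs.shift.mul (.var 0)))).congr fun _ => PAMinus.dvd_iff_exists_le

/-- The moduli of Gödel's `β`-function are pairwise relatively prime: for `i = j + e + 1`, the
identity `(j + 1) (1 + (i + 1) d) = (i + 1) (1 + (j + 1) d) - (e + 1)` shows that a common divisor
divides `e + 1`, hence `d`. -/
theorem PAMinus.dvd_of_dvd_modulus_mul [PAMinus N] {d n i j x : N} (hd : ∀ e < n, e + 1 ∣ d)
    (hi : i < n) (hj : j < n) (hij : i ≠ j) (h : 1 + (j + 1) * d ∣ (1 + (i + 1) * d) * x) :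
    1 + (j + 1) * d ∣ x := by
  obtain ⟨e, he, hdvd⟩ : ∃ e < n, 1 + (j + 1) * d ∣ (e + 1) * x := by
    rcases lt_or_gt_of_ne hij with hlt | hlt
    · obtain ⟨e, rfl⟩ := le_iff_exists_add.1 (PAMinus.add_one_le_iff.2 hlt)
      refine ⟨e, le_add_self.trans_lt hj, dvd_right_of_dvd_add
        (b := (1 + (i + 1 + e + 1) * d) * ((i + 1) * x)) (dvd_mul_right _ _) ?_⟩
      convert h.mul_left (i + 1 + e + 1) using 1
      ring
    · obtain ⟨e, rfl⟩ := le_iff_exists_add.1 (PAMinus.add_one_le_iff.2 hlt)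
      exact ⟨e, le_add_self.trans_lt hi, dvd_right_of_dvd_add (h.mul_left (j + 1))
        ⟨(j + 1 + e + 1) * x, by ring⟩⟩
  obtain ⟨d', rfl⟩ := hd e he
  refine dvd_right_of_dvd_add (b := (j + 1) * ((e + 1) * d') * x) ?_ ⟨x, by ring⟩
  convert hdvd.mul_left ((j + 1) * d') using 1
  ring

end Divisibility

namespace ModelsRCA0

variable {N : Type u} [CommSemiring N] [LinearOrder N] {𝒮 : Set (Set N)} {R : N → N → Prop}
  (hM : ModelsRCA0 𝒮)
include hM

theorem strong_induction (hR : BoundedRel 𝒮 R) (hmono : ∀ ⦃y y' x⦄, y ≤ y' → R y x → R y' x)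
    (step : ∀ x y, (∀ x' < x, R y x') → ∃ y', R y' x) (x : N) : ∃ y, R y x := by
  have := hM.paMinus
  refine (hM.induction (R := fun y x => ∀ x' < x, R y x') (.allLt (.var 1)
    (hR.comp (.var 1) (.var 0))) ⟨0, fun x' hx' => (zero_le.not_gt hx').elim⟩ ?_ (x + 1)).imp
    fun y hy => hy x (lt_add_one x)
  rintro x ⟨y, hy⟩
  obtain ⟨y', hy'⟩ := step x y hy
  refine ⟨max y y', fun x' hx' => ?_⟩
  rcases (PAMinus.lt_add_one_iff.1 hx').eq_or_lt with rfl | hlt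
  exacts [hmono (le_max_right y y') hy', hmono (le_max_left y y') (hy x' hlt)]

theorem exists_common_multiple {f : N → N} (hf : PolyFun fun v => f (v 0)) (hpos : ∀ i, 0 < f i)
    (n : N) : ∃ d, 0 < d ∧ ∀ i < n, f i ∣ d := by
  have := hM.paMinus
  refine hM.induction (R := fun d n => 0 < d ∧ ∀ i < n, f i ∣ d) (.and (.lt (.const 0) (.var 0))
    (.allLt (.var 1) (.dvd hf (.var 1)))) ⟨1, one_pos, fun i hi => (zero_le.not_gt hi).elim⟩ ?_ n
  rintro n ⟨d, hd, hdvd⟩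
  refine ⟨d * f n, mul_pos hd (hpos n), fun i hi => ?_⟩
  rcases (PAMinus.lt_add_one_iff.1 hi).eq_or_lt with rfl | hlt
  exacts [dvd_mul_left _ _, (hdvd i hlt).mul_right _]

/-- By induction on `c`: a modulus `m i` with a witness past the current bound may be divided out
of `c`, which leaves a modulus `m j`, `j ≠ i`, that does not divide the quotient. -/
theorem exists_modulus_not_dvd {n : N} {m : N → N} (hR : BoundedRel 𝒮 R)
    (hm : PolyFun fun v => m (v 0)) (one_lt : ∀ i, 1 < m i)
    (coprime : ∀ i < n, ∀ j < n, i ≠ j → ∀ x, m j ∣ m i * x → m j ∣ x)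
    (unbounded : ∀ s, ∃ i < n, (∃ y, R y i) ∧ ∀ y < s, ¬R y i) {c : N} (hc : 0 < c) :
    ∃ i < n, ¬m i ∣ c := by
  have := hM.paMinus
  obtain ⟨Q, hQ⟩ : ∃ Q : N → N → Prop, Q = fun s c =>
    0 < c → ∃ i < n, (∃ y < s, R y i) ∧ ¬m i ∣ c := ⟨_, rfl⟩
  have hQ_def : BoundedRel 𝒮 Q := hQ ▸ .imp (.lt (.const 0) (.var 1)) (.exLt (.const n) (.and
    (.exLt (.var 1) (hR.comp (.var 0) (.var 1))) (.not (.dvd hm (.var 2)))))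
  have hQ_mono ⦃s s' c⦄ (hss' : s ≤ s') (h : Q s c) : Q s' c := by
    subst hQ
    exact fun hc => (h hc).imp fun i ⟨hi, ⟨y, hy, hR⟩, hdvd⟩ =>
      ⟨hi, ⟨y, hy.trans_le hss', hR⟩, hdvd⟩
  have hQ_step (c s) (ih : ∀ c' < c, Q s c') : ∃ s', Q s' c := by
    subst hQ
    obtain ⟨i, hi, ⟨y, hy⟩, hnot⟩ := unbounded s
    refine ⟨max s (y + 1), fun hc => ?_⟩
    by_cases hic : m i ∣ c
    · obtain ⟨c', rfl⟩ := hic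
      have hc' : 0 < c' := pos_of_mul_pos_right hc zero_le
      obtain ⟨j, hj, ⟨z, hz, hzj⟩, hjc⟩ := ih c' (lt_mul_of_one_lt_left hc' (one_lt i)) hc'
      have hij : i ≠ j := fun h => hnot z hz (h ▸ hzj)
      exact ⟨j, hj, ⟨z, lt_max_of_lt_left hz, hzj⟩, fun hdvd => hjc (coprime i hi j hj hij c' hdvd)⟩
    · exact ⟨i, hi, ⟨y, lt_max_of_lt_right (lt_add_one y), hy⟩, hic⟩
  obtain ⟨s, hs⟩ := hM.strong_induction hQ_def hQ_mono hQ_step c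
  obtain ⟨i, hi, -, hdvd⟩ := (hQ ▸ hs : _ → _) hc
  exact ⟨i, hi, hdvd⟩

theorem exists_bound (hR : BoundedRel 𝒮 R) (n : N) :
    ∃ s, ∀ i < n, (∃ y, R y i) → ∃ y < s, R y i := by
  have := hM.paMinus
  obtain ⟨d, hd, hd_dvd⟩ := hM.exists_common_multiple (f := fun i => i + 1)
    (.add (.var 0) (.const 1)) PAMinus.add_one_pos n
  have modulus_poly : PolyFun fun v : ℕ → N => 1 + (v 0 + 1) * d :=
    .add (.const 1) (.mul (.add (.var 0) (.const 1)) (.const d))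
  have one_lt_modulus (i : N) : 1 < 1 + (i + 1) * d := by
    simpa only [lt_add_iff_pos_right] using mul_pos (PAMinus.add_one_pos i) hd
  obtain ⟨c, hc, hc_dvd⟩ := hM.exists_common_multiple (f := fun i => 1 + (i + 1) * d) modulus_poly
    (fun i => one_pos.trans (one_lt_modulus i)) n
  by_contra! unbounded
  obtain ⟨i, hi, hdvd⟩ := hM.exists_modulus_not_dvd (m := fun i => 1 + (i + 1) * d) hR modulus_poly
    one_lt_modulus (fun i hi j hj hij x => PAMinus.dvd_of_dvd_modulus_mul hd_dvd hi hj hij)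
    unbounded hc
  exact hdvd (hc_dvd i hi)

end ModelsRCA0

/-! ## Devlin's theorem in models of `RCA₀` -/

section ColoringGraph

variable {N : Type u} [CommSemiring N] {k l : ℕ}

/-- The code, in the sense of `IsColoringN`, of a coloring of the pairs of numbers. -/
def coloringGraph (f : N → N → Fin k) : Set N :=
  {z | ∃ p q, z = pairN (pairN p q) (f p q : ℕ)}

variable [LinearOrder N] [PAMinus N] {𝒮 : Set (Set N)}

theorem mem_coloringGraph {f : N → N → Fin k} {p q d : N} :
    pairN (pairN p q) d ∈ coloringGraph f ↔ d = (f p q : ℕ) := by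
  refine ⟨?_, fun h => ⟨p, q, h ▸ rfl⟩⟩
  rintro ⟨p', q', h⟩
  obtain ⟨hpq, rfl⟩ := pairN_inj.1 h
  obtain ⟨rfl, rfl⟩ := pairN_inj.1 hpq
  rfl

theorem isColoringN_coloringGraph (f : N → N → Fin k) : IsColoringN k (coloringGraph f) :=
  fun p q _ _ _ => ⟨(f p q : ℕ), Nat.cast_lt.2 (f p q).isLt, fun _ => mem_coloringGraph⟩

theorem ModelsDT2.exists_missed_color (hDT : ModelsDT2 𝒮 k l) (hlk : l < k) {f : N → N → Fin k}
    (hf : coloringGraph f ∈ 𝒮) : ∃ S ∈ 𝒮, IsDenseSuborderN S ∧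
      ∃ j : Fin k, ∀ p ∈ S, ∀ q ∈ S, ratLtN p q → f p q ≠ j := by
  obtain ⟨S, hS, hdense, c, hc⟩ := hDT _ hf (isColoringN_coloringGraph f)
  refine ⟨S, hS, hdense, ?_⟩
  by_contra! hall
  have (j : Fin k) : ∃ i, ((j : ℕ) : N) = c i :=
    let ⟨p, hp, q, hq, hpq, hj⟩ := hall j
    hc p hp q hq hpq _ (mem_coloringGraph.2 (hj ▸ rfl))
  choose g hg using this
  have hg_inj : Function.Injective g := fun j j' h =>
    Fin.ext (Nat.cast_injective (((hg j).trans (congrArg c h)).trans (hg j').symm))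
  exact hlk.not_ge (by simpa only [Fintype.card_fin] using Fintype.card_le_of_injective g hg_inj)

theorem BoundedDef.eq_pairColor {P Q : (ℕ → N) → Prop} {t : (ℕ → N) → N} (ht : PolyFun t)
    (hP : BoundedDef 𝒮 P) (hQ : BoundedDef 𝒮 Q) :
    BoundedDef 𝒮 fun v => t v = (pairColor (P v) (Q v) : ℕ) := by
  have h (c : N) : BoundedDef 𝒮 fun v => t v = c := .eq ht (.const c)
  refine ((hP.imp ((hQ.imp (h 3)).and (hQ.not.imp (h 2)))).and
    (hP.not.imp ((hQ.imp (h 1)).and (hQ.not.imp (h 0))))).congr fun v => ?_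
  by_cases P v <;> by_cases Q v <;> simp [pairColor, *]

theorem ModelsRCA0.coloringGraph_pairColor_mem (hM : ModelsRCA0 𝒮) {P Q : N → N → Prop}
    (hP : BoundedRel 𝒮 P) (hQ : BoundedRel 𝒮 Q) :
    coloringGraph (fun p q => pairColor (P p q) (Q p q)) ∈ 𝒮 := by
  refine hM.bounded_comprehension (.congr (.exists_pairN
    (R := fun x c _ => ∃ p q, x = pairN p q ∧ c = (pairColor (P p q) (Q p q) : ℕ)) (.var 0)
    (.exists_pairN (.var 1) (.eq_pairColor (.var 2) (hP.comp (.var 1) (.var 0))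
      (hQ.comp (.var 1) (.var 0)))))
    fun v => ⟨?_, ?_⟩)
  · rintro ⟨p, q, h⟩
    exact ⟨pairN p q, _, h, p, q, rfl, rfl⟩
  · rintro ⟨_, _, h, p, q, rfl, rfl⟩
    exact ⟨p, q, h⟩

end ColoringGraph

section Rationals

variable {N : Type u}

/-- The elements of a set `S` of rationals of a model, ordered as rationals. -/
structure RatIn (S : Set N) where
  code : N
  mem : code ∈ S

variable [CommSemiring N] [LinearOrder N]

/-- No number up to `i` is the code of a rational of the model that lies between `p` and `q`. -/
def IsNarrow (i p q : N) : Prop :=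
  ∀ r ≤ i, ¬(ratLtN p r ∧ ratLtN r q)

namespace RatIn

variable {S : Set N}

theorem nonempty (h : IsDenseSuborderN S) : Nonempty (RatIn S) :=
  let ⟨p, hp⟩ := h.2.1
  ⟨⟨p, hp⟩⟩

end RatIn

variable [PAMinus N] {𝒮 : Set (Set N)}

theorem BoundedDef.ratLtN {s t : (ℕ → N) → N} (hs : PolyFun s) (ht : PolyFun t) :
    BoundedDef 𝒮 fun v => ratLtN (s v) (t v) := by
  have ratLtN_iff (q r : N) : _root_.ratLtN q r ↔ ∃ x c, q = pairN x c ∧ ∃ y c', r = pairN y c' ∧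
      ∃ a b, x = pairN a b ∧ ∃ a' b', y = pairN a' b' ∧
        a * (c' + 1) + b' * (c + 1) < a' * (c + 1) + b * (c' + 1) := by
    constructor
    · rintro ⟨a, b, c, a', b', c', rfl, rfl, h⟩
      exact ⟨_, c, rfl, _, c', rfl, a, b, rfl, a', b', rfl, h⟩
    · rintro ⟨_, c, rfl, _, c', rfl, a, b, rfl, a', b', rfl, h⟩
      exact ⟨a, b, c, a', b', c', rfl, rfl, h⟩
  have mul_succ (i j : ℕ) : PolyFun fun v : ℕ → N => v i * (v j + 1) :=
    .mul (.var i) (.add (.var j) (.const 1))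
  exact (exists_pairN hs (exists_pairN ht.shift.shift (exists_pairN (.var 3) (exists_pairN (.var 3)
    (.lt (.add (mul_succ 3 4) (mul_succ 0 6)) (.add (mul_succ 1 6) (mul_succ 2 4))))))).congr
      fun v => ratLtN_iff (s v) (t v)

theorem BoundedDef.isNarrow {r s t : (ℕ → N) → N} (hr : PolyFun r) (hs : PolyFun s)
    (ht : PolyFun t) : BoundedDef 𝒮 fun v => IsNarrow (r v) (s v) (t v) :=
  .allLe hr (.not (.and (.ratLtN hs.shift (.var 0)) (.ratLtN (.var 0) ht.shift)))

namespace RatIn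

variable {S : Set N} {p q : RatIn S}

instance : IsStrictOrder (RatIn S) fun p q => ratLtN p.code q.code where
  irrefl _ h := h.asymm h
  trans _ _ _ := ratLtN.trans

instance : PartialOrder (RatIn S) :=
  partialOrderOfSO fun p q => ratLtN p.code q.code

theorem denselyOrdered (h : IsDenseSuborderN S) : DenselyOrdered (RatIn S) where
  dense p q hpq :=
    let ⟨r, hr, hpr, hrq⟩ := h.2.2.1 p.code p.mem q.code q.mem hpq
    ⟨⟨r, hr⟩, hpr, hrq⟩

theorem noMinOrder (h : IsDenseSuborderN S) : NoMinOrder (RatIn S) where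
  exists_lt p :=
    let ⟨r, hr, hrp⟩ := h.2.2.2.1 p.code p.mem
    ⟨⟨r, hr⟩, hrp⟩

theorem noMaxOrder (h : IsDenseSuborderN S) : NoMaxOrder (RatIn S) where
  exists_gt p :=
    let ⟨r, hr, hpr⟩ := h.2.2.2.2 p.code p.mem
    ⟨⟨r, hr⟩, hpr⟩

variable [DenselyOrdered (RatIn S)]

theorem exists_between_avoiding (hpq : p < q) (x : N) :
    ∃ σ τ, p < σ ∧ σ < τ ∧ τ < q ∧ ¬(ratLtN σ.code x ∧ ratLtN x τ.code) := by
  obtain ⟨ρ, hpρ, hρq⟩ := exists_between hpq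
  by_cases hx : ratLtN x ρ.code
  · obtain ⟨τ, hρτ, hτq⟩ := exists_between hρq
    exact ⟨ρ, τ, hpρ, hρτ, hτq, fun h => hx.asymm h.1⟩
  · obtain ⟨σ, hpσ, hσρ⟩ := exists_between hpρ
    exact ⟨σ, ρ, hpσ, hσρ, hρq, fun h => hx h.2⟩

theorem exists_isNarrow (hM : ModelsRCA0 𝒮) (hS : S ∈ 𝒮) (hpq : p < q) (i : N) :
    ∃ σ τ, p < σ ∧ σ < τ ∧ τ < q ∧ IsNarrow i σ.code τ.code := by
  suffices ∃ y a b, y = pairN a b ∧ a ∈ S ∧ b ∈ S ∧ ratLtN p.code a ∧ ratLtN a b ∧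
      ratLtN b q.code ∧ IsNarrow i a b by
    obtain ⟨-, a, b, -, ha, hb, hpa, hab, hbq, h⟩ := this
    exact ⟨⟨a, ha⟩, ⟨b, hb⟩, hpa, hab, hbq, h⟩
  refine hM.induction (R := fun y i => ∃ a b, y = pairN a b ∧ a ∈ S ∧ b ∈ S ∧ ratLtN p.code a ∧
    ratLtN a b ∧ ratLtN b q.code ∧ IsNarrow i a b) (.exists_pairN (.var 0) (.and (.mem hS (.var 1))
    (.and (.mem hS (.var 0)) (.and (.ratLtN (.const _) (.var 1)) (.and (.ratLtN (.var 1) (.var 0))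
    (.and (.ratLtN (.var 0) (.const _)) (.isNarrow (.var 3) (.var 1) (.var 0)))))))) ?_ ?_ i
  · obtain ⟨σ, τ, hpσ, hστ, hτq, h⟩ := exists_between_avoiding hpq 0
    refine ⟨_, σ.code, τ.code, rfl, σ.mem, τ.mem, hpσ, hστ, hτq, fun r hr => ?_⟩
    rwa [hr.antisymm zero_le]
  · rintro i ⟨-, a, b, -, ha, hb, hpa, hab, hbq, h⟩
    obtain ⟨σ, τ, haσ, hστ, hτb, hi⟩ :=
      exists_between_avoiding (p := ⟨a, ha⟩) (q := ⟨b, hb⟩) hab (i + 1)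
    refine ⟨_, σ.code, τ.code, rfl, σ.mem, τ.mem, hpa.trans haσ, hστ, hτb.trans hbq,
      fun r hr => ?_⟩
    rcases hr.eq_or_lt with rfl | hlt
    exacts [hi, fun ⟨hσr, hrτ⟩ =>
      h r (PAMinus.lt_add_one_iff.1 hlt) ⟨ratLtN.trans haσ hσr, hrτ.trans hτb⟩]

theorem isSizedOrder_code (hM : ModelsRCA0 𝒮) (hS : S ∈ 𝒮) :
    IsSizedOrder (code : RatIn S → N) fun i p q => IsNarrow i p.code q.code where
  exists_between hpq n := by
    obtain ⟨σ, τ, hpσ, hστ, hτq, hnarrow⟩ := exists_isNarrow hM hS hpq n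
    obtain ⟨ρ, hσρ, hρτ⟩ := exists_between hστ
    exact ⟨ρ, hpσ.trans hσρ, hρτ.trans hτq, not_le.1 fun h => hnarrow ρ.code h ⟨hσρ, hρτ⟩⟩
  close_left _ hrq h x hx hbetween := h x hx ⟨hbetween.1, hbetween.2.trans hrq⟩
  close_right hpr _ h x hx hbetween := h x hx ⟨ratLtN.trans hpr hbetween.1, hbetween.2⟩
  lt_size hpr hrq h := not_le.1 fun hr => h _ hr ⟨hpr, hrq⟩

end RatIn

end Rationals

section SigmaComprehension

variable {N : Type u} [LinearOrder N] {R : N → N → Prop}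

/-- The set `{i | ∃ y, R y i}` as known at stage `s` of the search for witnesses. -/
def witnessStage (R : N → N → Prop) (s : N) : Set N :=
  {i | ∃ y < s, R y i}

theorem monotone_witnessStage : Monotone (witnessStage R) :=
  fun _ _ hst _ ⟨y, hy, hR⟩ => ⟨y, hy.trans_le hst, hR⟩

variable [CommSemiring N] {𝒮 : Set (Set N)}

theorem iUnion_witnessStage [PAMinus N] : ⋃ s, witnessStage R s = {i | ∃ y, R y i} := by
  ext i
  simp only [Set.mem_iUnion]
  exact ⟨fun ⟨_, y, _, hR⟩ => ⟨y, hR⟩, fun ⟨y, hR⟩ => ⟨y + 1, y, lt_add_one y, hR⟩⟩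

theorem BoundedDef.mem_witnessStage {s t : (ℕ → N) → N} (hR : BoundedRel 𝒮 R) (hs : PolyFun s)
    (ht : PolyFun t) : BoundedDef 𝒮 fun v => t v ∈ witnessStage R (s v) :=
  .exLt hs (hR.comp (.var 0) ht.shift)

theorem BoundedRel.stagesAgree [PAMinus N] (hR : BoundedRel 𝒮 R) :
    BoundedRel 𝒮 (StagesAgree id IsNarrow (witnessStage R)) := by
  have agree (k : ℕ) : BoundedDef 𝒮 fun v => ∀ i < v k, IsNarrow i (v 0) (v 1) →
      (i ∈ witnessStage R (v 0) ↔ i ∈ witnessStage R (v 1)) :=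
    .allLt (.var k) (.imp (.isNarrow (.var 0) (.var 1) (.var 2))
      (.iff (.mem_witnessStage hR (.var 1) (.var 0)) (.mem_witnessStage hR (.var 2) (.var 0))))
  refine ((agree 0).and (agree 1)).congr fun v => ?_
  simp only [StagesAgree, lt_max_iff, or_imp, forall_and, id]

namespace ModelsRCA0

variable (hM : ModelsRCA0 𝒮) {A : Set N}
include hM

theorem mem_of_search {W D : N → N → Prop} (hW : BoundedRel 𝒮 W) (hD : BoundedRel 𝒮 D)
    (search : ∀ i, ∃ y, W y i) (decide : ∀ i y, W y i → (D y i ↔ i ∈ A)) : A ∈ 𝒮 := by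
  have mem_iff (i : N) : (∃ y, W y i ∧ D y i) ↔ i ∈ A :=
    ⟨fun ⟨y, hy, hd⟩ => (decide i y hy).1 hd,
      fun hi => let ⟨y, hy⟩ := search i; ⟨y, hy, (decide i y hy).2 hi⟩⟩
  have forall_iff (i : N) : (∀ y, W y i → D y i) ↔ i ∈ A :=
    ⟨fun h => let ⟨y, hy⟩ := search i; (decide i y hy).1 (h y hy),
      fun hi y hy => (decide i y hy).2 hi⟩
  simpa only [mem_iff, Set.ofPred_mem_eq] using
    hM.delta_comprehension (R := fun y i => W y i ∧ D y i) (Q := fun y i => W y i → D y i)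
      (.and hW hD) (.imp hW hD) fun i => (mem_iff i).trans (forall_iff i).symm

theorem mem_of_isNarrow [PAMinus N] {S : Set N} (hS : S ∈ 𝒮) (hdense : IsDenseSuborderN S)
    {E : N → N → N → Prop} (hE : BoundedDef 𝒮 fun v => E (v 1) (v 0) (v 3))
    (decide : ∀ i (p q : RatIn S), p < q → IsNarrow i p.code q.code → (E p.code q.code i ↔ i ∈ A)) :
    A ∈ 𝒮 := by
  refine hM.mem_of_search (W := fun y i => ∃ a b, y = pairN a b ∧ a ∈ S ∧ b ∈ S ∧ ratLtN a b ∧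
    IsNarrow i a b) (D := fun y i => ∃ a b, y = pairN a b ∧ E a b i)
    (.exists_pairN (.var 0) (.and (.mem hS (.var 1)) (.and (.mem hS (.var 0))
      (.and (.ratLtN (.var 1) (.var 0)) (.isNarrow (.var 3) (.var 1) (.var 0))))))
    (.exists_pairN (.var 0) hE) (fun i => ?_) ?_
  · have := RatIn.denselyOrdered hdense
    obtain ⟨p⟩ := RatIn.nonempty hdense
    obtain ⟨q, hpq⟩ := (RatIn.noMaxOrder hdense).exists_gt p
    obtain ⟨σ, τ, -, hστ, -, h⟩ := RatIn.exists_isNarrow hM hS hpq i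
    exact ⟨_, σ.code, τ.code, rfl, σ.mem, τ.mem, hστ, h⟩
  · rintro i _ ⟨a, b, rfl, ha, hb, hab, h⟩
    simpa only [pairN_inj, and_assoc, exists_eq_left', exists_and_left] using
      decide i ⟨a, ha⟩ ⟨b, hb⟩ hab h

end ModelsRCA0

theorem ModelsDT2.sigma_comprehension (hDT : ModelsDT2 𝒮 4 3) (hM : ModelsRCA0 𝒮)
    (hR : BoundedRel 𝒮 R) : {x | ∃ y, R y x} ∈ 𝒮 := by
  have := hM.paMinus
  obtain ⟨S, hS, hdense, c, hc⟩ := hDT.exists_missed_color (by norm_num)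
    (hM.coloringGraph_pairColor_mem (.lt (.var 0) (.var 1)) hR.stagesAgree)
  have := RatIn.nonempty hdense
  have := RatIn.denselyOrdered hdense
  have := RatIn.noMinOrder hdense
  have := RatIn.noMaxOrder hdense
  have hbound (n : N) :
      ∃ s, ∀ i < n, i ∈ ⋃ t, witnessStage R t → i ∈ witnessStage R s := by
    rw [iUnion_witnessStage]
    exact hM.exists_bound hR n
  rw [← iUnion_witnessStage]
  rcases (RatIn.isSizedOrder_code hM hS).mem_stage_left_or_right monotone_witnessStage hbound c
    fun p q hpq => hc p.code p.mem q.code q.mem hpq with h | h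
  · exact hM.mem_of_isNarrow hS hdense (E := fun p _ i => i ∈ witnessStage R p)
      (.mem_witnessStage hR (.var 1) (.var 3)) h
  · exact hM.mem_of_isNarrow hS hdense (E := fun _ q i => i ∈ witnessStage R q)
      (.mem_witnessStage hR (.var 0) (.var 3)) h

end SigmaComprehension

/-! ## Arithmetical comprehension -/

section DependsOn

theorem exists_dependsOn_map₂ {M α β γ : Type*} {f : (ℕ → M) → α} {g : (ℕ → M) → β}
    (op : α → β → γ) (hf : ∃ k, DependsOn f (Set.Iio k)) (hg : ∃ k, DependsOn g (Set.Iio k)) :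
    ∃ k, DependsOn (fun v => op (f v) (g v)) (Set.Iio k) := by
  obtain ⟨k, hk⟩ := hf
  obtain ⟨l, hl⟩ := hg
  exact ⟨max k l, fun v w h => congrArg₂ op
    (hk.mono (Set.Iio_subset_Iio (le_max_left k l)) h)
    (hl.mono (Set.Iio_subset_Iio (le_max_right k l)) h)⟩

variable {N : Type u} [CommSemiring N] {t : (ℕ → N) → N} {P : (ℕ → N) → Prop}

theorem PolyFun.exists_dependsOn (ht : PolyFun t) : ∃ k, DependsOn t (Set.Iio k) := by
  induction ht with
  | var i => exact ⟨i + 1, fun _ _ h => h i (Nat.lt_succ_self i)⟩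
  | const c => exact ⟨0, fun _ _ _ => rfl⟩
  | add _ _ ihs iht => exact exists_dependsOn_map₂ (· + ·) ihs iht
  | mul _ _ ihs iht => exact exists_dependsOn_map₂ (· * ·) ihs iht

variable [LinearOrder N] {𝒮 : Set (Set N)}

namespace BoundedDef

theorem exists_dependsOn (hP : BoundedDef 𝒮 P) : ∃ k, DependsOn P (Set.Iio k) := by
  induction hP with
  | lt hs ht => exact exists_dependsOn_map₂ (· < ·) hs.exists_dependsOn ht.exists_dependsOn
  | @mem A _ _ ht => exact ht.exists_dependsOn.imp fun k hk v w h => congrArg (· ∈ A) (hk h)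
  | not _ ih => exact ih.imp fun k hk v w h => congrArg Not (hk h)
  | and _ _ ihP ihQ => exact exists_dependsOn_map₂ And ihP ihQ
  | @exLt R _ ht _ ih =>
    refine exists_dependsOn_map₂ (g := fun v x => R x v) (fun b Q => ∃ x < b, Q x)
      ht.exists_dependsOn (ih.imp fun k hk v w h => funext fun x => ?_)
    refine hk (x := consVal x v) (y := consVal x w) ?_
    rintro (_ | i) hi
    exacts [rfl, h i ((Nat.lt_succ_self i).trans hi)]

variable [PAMinus N]

theorem exists_merge (hP : BoundedDef 𝒮 P) {k : ℕ} (hk : DependsOn P (Set.Iio (k + 3))) :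
    ∃ Q, BoundedDef 𝒮 Q ∧ DependsOn Q (Set.Iio (k + 2)) ∧ ∀ x a b v,
      P (consVal x (consVal a (consVal b v))) ↔ Q (consVal x (consVal (pairN a b) v)) := by
  refine ⟨fun w => ∃ a b, w 1 = pairN a b ∧ P (consVal (w 0) (consVal a (consVal b
    fun i => w (i + 2)))), ?_, fun v w hvw => ?_, fun x a b v => ?_⟩
  · refine .exists_pairN (R := fun a b w => P (consVal (w 0) (consVal a (consVal b
      fun i => w (i + 2))))) (.var 1) (hP.subst ?_)
    rintro (_ | _ | _ | i)
    exacts [.var 2, .var 1, .var 0, .var (i + 4)]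
  · simp only [hvw 1 (by simp)]
    congr! 5 with a b
    refine Eq.to_iff (hk ?_)
    rintro (_ | _ | _ | i) hi
    exacts [hvw 0 (by simp), rfl, rfl, hvw (i + 2) (by simpa using hi)]
  · simp only [consVal, pairN_inj, and_assoc, exists_and_left, exists_eq_left']

/-- All variables but the first are merged into one by pairing. -/
theorem exists_boundedRel (hP : BoundedDef 𝒮 P) (k : ℕ) (hk : DependsOn P (Set.Iio (k + 2))) :
    ∃ (R : N → N → Prop) (t : (ℕ → N) → N), BoundedRel 𝒮 R ∧ PolyFun t ∧
      ∀ x v, P (consVal x v) ↔ R x (t v) := by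
  induction k generalizing P with
  | zero =>
    refine ⟨fun x z => P (consVal x fun _ => z), fun v => v 0,
      hP.subst (σ := fun v => consVal (v 0) fun _ => v 1) ?_, .var 0, fun x v => Eq.to_iff (hk ?_)⟩
    · rintro (_ | _)
      exacts [.var 0, .var 1]
    · rintro (_ | _ | i) hi
      exacts [rfl, rfl, by simp at hi]
  | succ k ih =>
    obtain ⟨Q, hQ, hQk, hPQ⟩ := hP.exists_merge hk
    obtain ⟨R, t, hR, ht, hQR⟩ := ih hQ hQk
    refine ⟨R, fun v => t (consVal (pairN (v 0) (v 1)) fun i => v (i + 2)), hR,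
      ht.subst (σ := fun v => consVal (pairN (v 0) (v 1)) fun i => v (i + 2)) ?_, fun x v => ?_⟩
    · rintro (_ | i)
      exacts [.pairN (.var 0) (.var 1), .var (i + 2)]
    · have cons_eta : consVal (v 0) (consVal (v 1) fun i => v (i + 2)) = v := by
        funext i
        rcases i with _ | _ | i <;> rfl
      rw [← hQR, ← hPQ, cons_eta]

end BoundedDef

end DependsOn

section ArithmeticalComprehension

variable {N : Type u} [CommSemiring N]

theorem NumTerm.polyFun_eval (t : NumTerm) : PolyFun fun v : ℕ → N => t.eval v := by
  induction t with
  | var n => exact .var n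
  | zero => exact .const 0
  | one => exact .const 1
  | add _ _ ihs iht => exact ihs.add iht
  | mul _ _ ihs iht => exact ihs.mul iht

variable [LinearOrder N] {𝒮 : Set (Set N)} {P : (ℕ → N) → Prop}

theorem BoundedDef.exists_consVal [PAMinus N]
    (hSigma : ∀ R, BoundedRel 𝒮 R → {x | ∃ y, R y x} ∈ 𝒮) (hP : BoundedDef 𝒮 P) :
    BoundedDef 𝒮 fun v => ∃ x, P (consVal x v) := by
  obtain ⟨k, hk⟩ := hP.exists_dependsOn
  obtain ⟨R, t, hR, ht, h⟩ := hP.exists_boundedRel k fun v w hvw =>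
    hk fun i hi => hvw i (Nat.lt_add_right 2 hi)
  exact (mem (hSigma R hR) ht).congr fun v => by simp only [h, Set.mem_ofPred_eq]

theorem ArithFormula.boundedDef_holds [PAMinus N]
    (hSigma : ∀ R, BoundedRel 𝒮 R → {x | ∃ y, R y x} ∈ 𝒮) {V : ℕ → Set N} (hV : ∀ i, V i ∈ 𝒮)
    (φ : ArithFormula) : BoundedDef 𝒮 fun v => φ.Holds V v := by
  have cons_eta (w : ℕ → N) : consVal (w 0) (fun i => w (i + 1)) = w := by
    funext i
    cases i <;> rfl
  induction φ with
  | eq s t => exact .eq s.polyFun_eval t.polyFun_eval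
  | lt s t => exact .lt s.polyFun_eval t.polyFun_eval
  | mem t X => exact .mem (hV X) t.polyFun_eval
  | not _ ih => exact ih.not
  | and _ _ ih ih' => exact ih.and ih'
  | or _ _ ih ih' => exact ih.or ih'
  | allLt t _ ih => exact .allLt t.polyFun_eval (ih.congr fun w => by rw [cons_eta])
  | exLt t _ ih => exact .exLt t.polyFun_eval (ih.congr fun w => by rw [cons_eta])
  | all _ ih => exact (ih.not.exists_consVal hSigma).not.congr fun v => not_exists_not.symm
  | ex _ ih => exact ih.exists_consVal hSigma

theorem ModelsDT2.modelsACA0 (hDT : ModelsDT2 𝒮 4 3) (hM : ModelsRCA0 𝒮) : ModelsACA0 𝒮 where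
  rca0 := hM
  arithmetical_comprehension φ V v hV := by
    have := hM.paMinus
    have hφ := φ.boundedDef_holds (fun R hR => hDT.sigma_comprehension hM hR) hV
    refine hM.bounded_comprehension (hφ.subst (σ := fun w => consVal (w 0) v) ?_)
    rintro (_ | i)
    exacts [.var 0, .const (v i)]

end ArithmeticalComprehension

theorem mainTheorem9 :
    -- a computable instance all of whose solutions compute the halting set
    (∃ f : ℚ → ℚ → Fin 4, IsComputableColoring f ∧
      ∀ S : Set ℚ, IsDevlinSolution 3 f S → RatSetComputes S haltingSet) ∧
    -- the explicit product coloring has this property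
    (∃ e : ℚ ≃ List Bool, IsComputableStringIso e) ∧
    (∀ e : ℚ ≃ List Bool, IsComputableStringIso e →
      ∀ (K : Set ℕ) (A : ℕ → Set ℕ), IsCompleteSigma1 K → IsComputableEnumeration A K →
        IsComputableColoring (fun p q => productColoring A (e p) (e q)) ∧
        ∀ S : Set ℚ, IsDevlinSolution 3 (fun p q => productColoring A (e p) (e q)) S →
          RatSetComputes S haltingSet) ∧
    -- the implication over the base theory, in all models
    (∀ (N : Type u) [CommSemiring N] [LinearOrder N] (𝒮 : Set (Set N)),
      ModelsRCA0 𝒮 → ModelsDT2 𝒮 4 3 → ModelsACA0 𝒮) := by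
  obtain ⟨e, he⟩ := exists_isComputableStringIso
  have hK := isCompleteSigma1_haltingSet
  have hA := isComputableEnumeration_haltingStage
  refine ⟨⟨_, he.isComputableColoring hA.1, fun S hS => ?_⟩, ⟨e, he⟩,
    fun e he K A hK hA => ⟨he.isComputableColoring hA.1, fun S hS => ?_⟩, fun N _ _ 𝒮 hM hDT => ?_⟩
  · exact hS.ratSetComputes_haltingSet he hK hA
  · exact hS.ratSetComputes_haltingSet he hK hA
  · exact hDT.modelsACA0 hM
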